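/- Consider the rank-$4$ tensorial group field theory on $\mathrm U(1)$ with closure constraint and covariance slices $$C_i(\theta;\theta')=\int_{s_i}d\alpha\,e^{-m^2\alpha}\int dh\prod_{\ell=1}^4K_\alpha(\theta_\ell+h-\theta'_\ell),\qquad s_0=[1,\infty),\quad s_i=[M^{-2i},M^{-2(i-1)}]\ (i\ge1),$$ where $M>1$, $m>0$, $K_\alpha$ is the heat kernel of $\mathrm U(1)$ and $dh$ is the normalized Haar measure. A Feynman graph $\mathcal G$ is a finite bipartite graph with white and black nodes, in which each of the colours $1,\dots,4$ is a perfect matching and the colour $0$ is a partial matching. Its $L(\mathcal G)$ lines are the edges of colour $0$. Its external legs are the nodes without line. Its vertices ($4$-bubbles) are the connected components left after removing the colour $0$. Its faces of colour $\ell$ are the connected components of the part made of the colours $0$ and $\ell$. A face is open if it contains an external leg, and closed otherwise. Each external leg carries one boundary angle for each colour. For a scale attribution $\mu=(i_e)_e\in\mathbb N^{L(\mathcal G)}$, the amplitude is the distribution in the boundary angles $$\mathcal A_{\mathcal G,\mu}=\Big[\prod_{e}\int_{s_{i_e}}d\alpha_e\,e^{-m^2\alpha_e}\int dh_e\Big]\prod_{f\text{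 closed}}K_{\alpha(f)}\Big(\sum_{e\in f}h_e\Big)\prod_{f\text{ open}}K_{\alpha(f)}\Big(\theta_{s(f)}+\sum_{e\in f}h_e-\theta_{t(f)}\Big),$$ where lines are oriented from white to black, $\alpha(f)=\sum_{e\in f}\alpha_e$, $\theta_{s(f)},\theta_{t(f)}$ are the boundary angles at the black and the white end of $f$, and $K_0=\delta$. A subgraph is a set $\mathcal H$ of lines. Its internal faces are the closed faces of $\mathcal G$ that pass only through lines of $\mathcal H$. It is connected if it is nonempty and its incidence matrix between lines and internal faces does not factorize into several blocks. Contracting a line with ends $w,b$ means deleting $w$, $b$ and the edges joining them, and joining, in each remaining colour, the former neighbours of $w$ and $b$. A melopole is a connected subgraph, all of whose lines have both ends on one and the same bubble, that admits an ordering of its lines such that the two ends of each line, after contraction of the preceding lines, are joined by at least three edges of colours $1,\dots,4$. **Proposition.** Let $M>1$, $m>0$ and $p\in\mathbb N$. There is $K>0$ such that for every connected non-vacuum graph $\mathcal G$ (i.e. with at least one external leg) that has no melopole and whose bubbles have at most $p$ nodes, and for every measurable function $u$ of the boundary angles with $|u|\le1$, the integrals defining $\mathcal A_{\mathcal G,\mu}(u)$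 (paired with the normalized measure of the boundary angles) converge absolutely for every $\mu$, the sum over $\mu$ converges absolutely, and $$\sum_{\mu}|\mathcal A_{\mathcal G,\mu}(u)|\le K^{L(\mathcal G)}.$$ In particular ($u=1$) this holds for the amputated amplitudes, in which the open faces are discarded. -/

import Mathlib

open MeasureTheory

noncomputable section

/-- A Feynman graph of the rank-4 model, given by its 5-coloured extension.
`W`, `B` are the white and black nodes (fields `φ`, `φ̄`), `L` is the set of (internal) lines.
Each colour `ℓ` gives a perfect matching of white with black nodes (the colored lines);
the lines, of colour 0, form a partial matching. Nodes without a line are the external legs. -/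
structure TensorGraph (W B L : Type) where
  color : Fin 4 → W ≃ B
  whiteEnd : L ↪ W
  blackEnd : L ↪ B

namespace TensorGraph

variable {W B L : Type}

/-- `w` and `b` are joined by a line of the given colour; `none` is the colour 0. -/
def Joined (G : TensorGraph W B L) : Option (Fin 4) → W → B → Prop
  | none, w, b => ∃ e, G.whiteEnd e = w ∧ G.blackEnd e = b
  | some ℓ, w, b => G.color ℓ w = b

/-- The part of the coloured extension made of all nodes and of the lines with colour in `C`. -/
def coloredPart (G : TensorGraph W B L) (C : Set (Option (Fin 4))) : SimpleGraph (W ⊕ B) :=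
  SimpleGraph.fromRel fun x y =>
    ∃ k ∈ C, ∃ w b, x = Sum.inl w ∧ y = Sum.inr b ∧ G.Joined k w b

/-- `G` is connected (its coloured extension is). -/
def IsConnected (G : TensorGraph W B L) : Prop :=
  (G.coloredPart Set.univ).Connected

/-- The vertices of `G`: its 4-bubbles, the connected components left without colour 0. -/
abbrev Bubble (G : TensorGraph W B L) : Type :=
  (G.coloredPart {none}ᶜ).ConnectedComponent

/-- Every bubble of `G` has order (number of nodes) at most `p`. -/
def OrderLE (G : TensorGraph W B L) (p : ℕ) : Prop :=
  ∀ v : G.Bubble, v.supp.ncard ≤ p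

/-- White external legs. -/
abbrev ExtWhite (G : TensorGraph W B L) : Type := {w : W // w ∉ Set.range G.whiteEnd}

/-- Black external legs. -/
abbrev ExtBlack (G : TensorGraph W B L) : Type := {b : B // b ∉ Set.range G.blackEnd}

/-- A vacuum graph has no external leg. -/
def IsVacuum (G : TensorGraph W B L) : Prop :=
  IsEmpty G.ExtWhite ∧ IsEmpty G.ExtBlack

/-! ### Faces -/

/-- Faces, closed or open: the alternating circuits and paths of colours 0 and `ℓ`. -/
abbrev Face (G : TensorGraph W B L) : Type :=
  Σ ℓ : Fin 4, (G.coloredPart {none, some ℓ}).ConnectedComponent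

/-- A face is closed when no external leg lies on it. -/
def IsClosedFace (G : TensorGraph W B L) (f : G.Face) : Prop :=
  (∀ w : G.ExtWhite, Sum.inl w.1 ∉ f.2.supp) ∧ ∀ b : G.ExtBlack, Sum.inr b.1 ∉ f.2.supp

/-- The line `e` belongs to the boundary of the face `f`. If every line is oriented from its
white to its black end, then each face runs through all its lines in the same direction; with
the faces oriented accordingly, `ε_{ef}` is `1` if `e` is on `f` and `0` otherwise. -/
def OnFace (G : TensorGraph W B L) (e : L) (f : G.Face) : Prop :=
  Sum.inl (G.whiteEnd e) ∈ f.2.supp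

open Classical in
/-- The sum of `x e` over the lines `e` of the face `f`. -/
def faceSum [Fintype L] (G : TensorGraph W B L) (x : L → ℝ) (f : G.Face) : ℝ :=
  ∑ e with G.OnFace e f, x e

/-- The open face of colour `ℓ` that starts at the external leg `b`. -/
def openFace (G : TensorGraph W B L) (ℓ : Fin 4) (b : G.ExtBlack) : G.Face :=
  ⟨ℓ, (G.coloredPart {none, some ℓ}).connectedComponentMk (Sum.inr b.1)⟩

/-! ### Melopoles -/

/-- Internal faces of a subgraph `H` (a set of lines): the closed faces of `G` that pass only
through lines of `H` (and through at least one line, as every closed face does). -/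
def IsInternalFace (G : TensorGraph W B L) (H : Set L) (f : G.Face) : Prop :=
  G.IsClosedFace f ∧ ∀ e, G.OnFace e f → e ∈ H

/-- A subgraph is connected when the incidence matrix between its lines and its internal faces
does not factorize into several rectangular blocks. -/
def IsConnectedSubgraph (G : TensorGraph W B L) (H : Set L) : Prop :=
  H.Nonempty ∧ ∀ S ⊆ H, S.Nonempty →
    (∀ f, G.IsInternalFace H f →
      (∀ e, G.OnFace e f → e ∈ S) ∨ (∀ e, G.OnFace e f → e ∉ S)) → S = H

/-- With colored lines `c`, a line joining `w` to `b` is a `k`-dipole for this `k`. -/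
def dipoleOrder (c : Fin 4 → W ≃ B) (w : W) (b : B) : ℕ :=
  1 + {ℓ : Fin 4 | c ℓ w = b}.ncard

open Classical in
/-- Contraction of a line joining `w` to `b`: in each colour, the partner of `b` is reconnected
to the partner of `w`. Instead of being deleted, `w` and `b` are left as an isolated pair,
joined to each other in all colours. -/
def contractLine (c : Fin 4 → W ≃ B) (w : W) (b : B) : Fin 4 → W ≃ B :=
  fun ℓ => (c ℓ).trans (Equiv.swap b (c ℓ w))

/-- Along the list of lines, each line is a melonic dipole once its predecessors have been
contracted. The order is 4, except that it is 5 for the last line of a vacuum melopole. -/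
def IsHeppSector (G : TensorGraph W B L) : (Fin 4 → W ≃ B) → List L → Prop
  | _, [] => True
  | c, e :: es => 4 ≤ dipoleOrder c (G.whiteEnd e) (G.blackEnd e) ∧
      IsHeppSector G (contractLine c (G.whiteEnd e) (G.blackEnd e)) es

/-- A melopole: a (nonempty) connected single-vertex subgraph whose lines can be ordered so that
each of them is a melonic dipole after contraction of the previous ones. -/
def IsMelopole (G : TensorGraph W B L) (H : Set L) : Prop :=
  G.IsConnectedSubgraph H ∧
  (∃ v : G.Bubble, ∀ e ∈ H,
    Sum.inl (G.whiteEnd e) ∈ v.supp ∧ Sum.inr (G.blackEnd e) ∈ v.supp) ∧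
  ∃ l : List L, l.Nodup ∧ {e | e ∈ l} = H ∧ G.IsHeppSector G.color l

/-- Fully convergent graphs: those without melopole. -/
def FullyConvergent (G : TensorGraph W B L) : Prop :=
  ∀ H : Set L, ¬ G.IsMelopole H

end TensorGraph

/-! ### Amplitudes -/

/-- The heat kernel at time `α` on `U(1)`, in the angle coordinate, with respect to the normalized
Haar measure. -/
def heatKernel (α θ : ℝ) : ℝ :=
  √(Real.pi / α) * ∑' n : ℤ, Real.exp (-(θ - 2 * Real.pi * n) ^ 2 / (4 * α))

/-- Normalized Haar measure of `U(1)` in the angle coordinate `θ ∈ [0, 2π)`. -/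
def haarAngle : Measure ℝ :=
  (ENNReal.ofReal (2 * Real.pi))⁻¹ • volume.restrict (Set.Ico 0 (2 * Real.pi))

/-- The slice of Schwinger parameters of scale `i`: `[1, ∞)` for `i = 0`, and
`[M ^ (-2 i), M ^ (-2 (i - 1))]` for `i ≥ 1`. -/
def slice (M : ℝ) : ℕ → Set ℝ
  | 0 => Set.Ici 1
  | i + 1 => Set.Icc (M ^ (2 * (i + 1)))⁻¹ (M ^ (2 * i))⁻¹

namespace TensorGraph

variable {W B L : Type}

/-- Values of the boundary variables: one angle for each external leg and colour, first those of
the black legs (sources of the open faces), then those of the white legs (targets). -/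
abbrev Boundary (G : TensorGraph W B L) : Type :=
  (Fin 4 × G.ExtBlack → ℝ) × (Fin 4 × G.ExtWhite → ℝ)

/-- The integration variables `(α, (h, g))` of an amplitude. -/
abbrev Config (G : TensorGraph W B L) : Type :=
  (L → ℝ) × (L → ℝ) × G.Boundary

open Classical in
/-- An open face that contains no line has kernel `K_0`, a Dirac mass: it sets its target
variable equal to its source variable. -/
def identify (G : TensorGraph W B L) (g : G.Boundary) : G.Boundary :=
  (g.1, fun x =>
    if hx : G.color x.1 x.2.1 ∉ Set.range G.blackEnd
      then g.1 (x.1, ⟨G.color x.1 x.2.1, hx⟩) else g.2 x)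

open Classical in
/-- The heat kernels of the closed faces. -/
def closedKernel [Fintype W] [Fintype B] [Fintype L] (G : TensorGraph W B L)
    (α h : L → ℝ) : ℝ :=
  letI := Fintype.ofFinite G.Face
  ∏ f : G.Face with G.IsClosedFace f, heatKernel (G.faceSum α f) (G.faceSum h f)

open Classical in
/-- The heat kernels of the open faces that contain at least one line. Such a face is
described by its colour, its source `b` and its target `w`. -/
def openKernel [Fintype W] [Fintype B] [Fintype L] (G : TensorGraph W B L)
    (α h : L → ℝ) (g : G.Boundary) : ℝ :=
  ∏ ℓ : Fin 4, ∏ b : G.ExtBlack, ∏ w : G.ExtWhite,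
    if (G.coloredPart {none, some ℓ}).Reachable (Sum.inr b.1) (Sum.inl w.1) ∧
        G.color ℓ w.1 ≠ b.1
      then heatKernel (G.faceSum α (G.openFace ℓ b))
        (g.1 (ℓ, b) + G.faceSum h (G.openFace ℓ b) - g.2 (ℓ, w))
      else 1

open Classical in
/-- The measure `∏ dα_e ∏ dh_e ∏ dg`, with `α_e` in the slice of scale `μ e`. -/
def scaleMeasure [Fintype W] [Fintype B] [Fintype L] (G : TensorGraph W B L)
    (M : ℝ) (μ : L → ℕ) : Measure G.Config :=
  (Measure.pi fun e => volume.restrict (slice M (μ e))).prod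
    ((Measure.pi fun _ => haarAngle).prod
      ((Measure.pi fun _ => haarAngle).prod (Measure.pi fun _ => haarAngle)))

/-- The integrand of the amplitude with mass `m`, paired with a function `u` of the boundary
variables. -/
def integrand [Fintype W] [Fintype B] [Fintype L] (G : TensorGraph W B L)
    (m : ℝ) (u : G.Boundary → ℂ) (x : G.Config) : ℂ :=
  ((∏ e, Real.exp (-m ^ 2 * x.1 e)) * G.closedKernel x.1 x.2.1 *
    G.openKernel x.1 x.2.1 x.2.2 : ℝ) * u (G.identify x.2.2)

/-- The amplitude `A_{G,μ}` at scale attribution `μ`, a distribution in the boundary variables,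
evaluated on the function `u`. -/
def amplitude [Fintype W] [Fintype B] [Fintype L] (G : TensorGraph W B L)
    (M m : ℝ) (μ : L → ℕ) (u : G.Boundary → ℂ) : ℂ :=
  ∫ x, G.integrand m u x ∂(G.scaleMeasure M μ)

end TensorGraph

end

/-! Fix the scales `μ`. The closed faces are split into a set `P` and the rest, whose holonomies
(sums of the `h_e` along a face) are linearly independent. Kernels of faces in `P` are bounded
uniformly by `C * M ^ i_f`, with `i_f` the lowest scale on `f` (`exists_heatKernel_le`). The other
closed faces have independent uniform holonomies, so their kernels integrate to at most 1
(`lintegral_prod_holonomies`). So do the open faces, over their target angles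
(`lintegral_openKernel_le`). Each line gains `M ^ (-2 i_e)` from its Schwinger integral. It remains
to show that the sum of `i_f` over `P` is at most `2 - 1/(2p)` times the sum of the `i_e`
(`exists_face_splitting`); the sum over `μ` is then a product of geometric series.

This is checked level by level. With `H` the lines of scale above `i`, the faces of `P` of scale
above `i` number at most the dimension of `momenta H`, the number of internal faces minus the rank
of the incidence matrix. Order the lines and let `k_e` count the internal faces of which `e` is the
last line. Elimination from the last line bounds the dimension by the sum of `k_e - 1` over the
lines with `k_e ≥ 1` (`finrank_momenta_le`). Ordering towards an external leg gives `k_e ≤ 3`, hence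
at most 2 per line. Without melopoles, each bubble touched by `H` meets a line with `k_e ≤ 2`, which
contributes at most 1 (`exists_closingNumber_le_two`). As bubbles have at most `p` nodes, such lines
form a fraction at least `1/(2p)` of `H`, and this is the gain. -/

noncomputable section

namespace TensorGraph

variable {W B L : Type}

/-! ### Faces as reachability classes -/

/-- The face of colour `ℓ` through the line `e`. -/
def faceAt (G : TensorGraph W B L) (ℓ : Fin 4) (e : L) : G.Face :=
  ⟨ℓ, (G.coloredPart {none, some ℓ}).connectedComponentMk (Sum.inl (G.whiteEnd e))⟩

theorem onFace_iff (G : TensorGraph W B L) (e : L) (f : G.Face) :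
    G.OnFace e f ↔ G.faceAt f.1 e = f := by
  obtain ⟨ℓ, c⟩ := f
  simp [OnFace, faceAt, SimpleGraph.ConnectedComponent.mem_supp_iff]

theorem onFace_faceAt (G : TensorGraph W B L) (ℓ : Fin 4) (e : L) :
    G.OnFace e (G.faceAt ℓ e) := by
  simp [OnFace, faceAt]

theorem reachable_of_joined (G : TensorGraph W B L) {C : Set (Option (Fin 4))} {k} (hk : k ∈ C)
    {w : W} {b : B} (h : G.Joined k w b) :
    (G.coloredPart C).Reachable (Sum.inl w) (Sum.inr b) := by
  refine SimpleGraph.Adj.reachable ?_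
  rw [coloredPart, SimpleGraph.fromRel_adj]
  exact ⟨by simp, Or.inl ⟨k, hk, w, b, rfl, rfl, h⟩⟩

theorem reachable_color (G : TensorGraph W B L) {C : Set (Option (Fin 4))} {ℓ : Fin 4}
    (h : some ℓ ∈ C) (w : W) :
    (G.coloredPart C).Reachable (Sum.inl w) (Sum.inr (G.color ℓ w)) :=
  G.reachable_of_joined h (show G.color ℓ w = _ from rfl)

theorem reachable_line (G : TensorGraph W B L) {C : Set (Option (Fin 4))} (h : none ∈ C) (e : L) :
    (G.coloredPart C).Reachable (Sum.inl (G.whiteEnd e)) (Sum.inr (G.blackEnd e)) :=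
  G.reachable_of_joined h ⟨e, rfl, rfl⟩

/-- Reachability is the smallest equivalence relation containing the edges. Later arguments choose a
suitable `r` instead of following paths. -/
theorem rel_of_reachable (G : TensorGraph W B L) {C : Set (Option (Fin 4))} (r : Setoid (W ⊕ B))
    (hr : ∀ k ∈ C, ∀ w b, G.Joined k w b → r (Sum.inl w) (Sum.inr b)) {x y : W ⊕ B}
    (h : (G.coloredPart C).Reachable x y) : r x y := by
  obtain ⟨p⟩ := h
  induction p with
  | nil => exact r.refl _
  | cons hadj _ ih =>
    refine r.trans ?_ ih
    rw [coloredPart, SimpleGraph.fromRel_adj] at hadj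
    obtain ⟨-, ⟨k, hk, w, b, rfl, rfl, h⟩ | ⟨k, hk, w, b, rfl, rfl, h⟩⟩ := hadj
    · exact hr k hk w b h
    · exact r.symm (hr k hk w b h)

/-- A face joins two nodes of a component-like relation as soon as all its lines do. -/
theorem rel_of_mem_face (G : TensorGraph W B L) (r : Setoid (W ⊕ B)) (f : G.Face)
    (hc : ∀ w, r (Sum.inl w) (Sum.inr (G.color f.1 w)))
    (hl : ∀ e, G.OnFace e f → r (Sum.inl (G.whiteEnd e)) (Sum.inr (G.blackEnd e)))
    {x y : W ⊕ B} (hx : x ∈ f.2.supp) (hy : y ∈ f.2.supp) : r x y := by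
  rw [SimpleGraph.ConnectedComponent.mem_supp_iff] at hx hy
  have hxy : (G.coloredPart {none, some f.1}).Reachable x y :=
    SimpleGraph.ConnectedComponent.exact (hx.trans hy.symm)
  -- All nodes off the face are put into one class, so that `hl` is needed only for lines on the
  -- face.
  let s : Setoid (W ⊕ B) :=
    { r := fun a b => (a ∈ f.2.supp ∧ b ∈ f.2.supp ∧ r a b) ∨ (a ∉ f.2.supp ∧ b ∉ f.2.supp)
      iseqv := by
        refine ⟨fun a => ?_, ?_, ?_⟩
        · by_cases h : a ∈ f.2.supp
          · exact Or.inl ⟨h, h, r.refl a⟩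
          · exact Or.inr ⟨h, h⟩
        · rintro a b (⟨h1, h2, h3⟩ | ⟨h1, h2⟩)
          · exact Or.inl ⟨h2, h1, r.symm h3⟩
          · exact Or.inr ⟨h2, h1⟩
        · rintro a b c (⟨h1, h2, h3⟩ | ⟨h1, h2⟩) (⟨h4, h5, h6⟩ | ⟨h4, h5⟩)
          · exact Or.inl ⟨h1, h5, r.trans h3 h6⟩
          · exact absurd h2 h4
          · exact absurd h4 h2
          · exact Or.inr ⟨h1, h5⟩ }
  have hs : s x y := by
    refine G.rel_of_reachable s ?_ hxy
    intro k hk w b hj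
    have hreach := G.reachable_of_joined hk hj
    have hiff : Sum.inl w ∈ f.2.supp ↔ Sum.inr b ∈ f.2.supp := by
      simp only [SimpleGraph.ConnectedComponent.mem_supp_iff]
      rw [SimpleGraph.ConnectedComponent.sound hreach]
    by_cases hw : Sum.inl w ∈ f.2.supp
    · refine Or.inl ⟨hw, hiff.1 hw, ?_⟩
      rcases hk with rfl | hk
      · obtain ⟨e, rfl, rfl⟩ := hj
        exact hl e hw
      · rw [Set.mem_singleton_iff] at hk
        subst hk
        have := hc w
        rwa [show G.color f.1 w = b from hj] at this
    · exact Or.inr ⟨hw, fun h => hw (hiff.2 h)⟩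
  rcases hs with ⟨-, -, h⟩ | ⟨h, -⟩
  · exact h
  · exact absurd ((SimpleGraph.ConnectedComponent.mem_supp_iff _ _).2 hx) h

theorem IsClosedFace.exists_onFace {G : TensorGraph W B L} {f : G.Face} (h : G.IsClosedFace f) :
    ∃ e, G.OnFace e f := by
  obtain ⟨ℓ, c⟩ := f
  induction c using SimpleGraph.ConnectedComponent.ind with
  | h x =>
    have key : ∃ w, (G.coloredPart {none, some ℓ}).connectedComponentMk (Sum.inl w) =
        (G.coloredPart {none, some ℓ}).connectedComponentMk x := by
      rcases x with w | b
      · exact ⟨w, rfl⟩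
      · refine ⟨(G.color ℓ).symm b, SimpleGraph.ConnectedComponent.sound ?_⟩
        simpa using G.reachable_color (C := {none, some ℓ}) (ℓ := ℓ) (by simp) ((G.color ℓ).symm b)
    obtain ⟨w, hw⟩ := key
    by_cases hr : w ∈ Set.range G.whiteEnd
    · obtain ⟨e, rfl⟩ := hr
      exact ⟨e, hw⟩
    · exact absurd hw (h.1 ⟨w, hr⟩)

theorem IsClosedFace.exists_black {G : TensorGraph W B L} {f : G.Face} (h : G.IsClosedFace f)
    {b : B} (hb : Sum.inr b ∈ f.2.supp) : ∃ e, G.blackEnd e = b ∧ G.OnFace e f := by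
  by_cases hr : b ∈ Set.range G.blackEnd
  · obtain ⟨e, rfl⟩ := hr
    refine ⟨e, rfl, ?_⟩
    rw [SimpleGraph.ConnectedComponent.mem_supp_iff] at hb
    rw [OnFace, SimpleGraph.ConnectedComponent.mem_supp_iff, ← hb]
    exact SimpleGraph.ConnectedComponent.sound (G.reachable_line (by simp) e)
  · exact absurd hb (h.2 ⟨b, hr⟩)

/-! ### Contraction of a set of lines -/

/-- The coloured lines `c` result from `G` by the contraction of the lines of `A`. -/
structure IsContraction (G : TensorGraph W B L) (c : Fin 4 → W ≃ B) (A : Set L) : Prop where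
  isolated : ∀ ℓ, ∀ e ∈ A, c ℓ (G.whiteEnd e) = G.blackEnd e
  -- A coloured line of `c` stands for a path of old lines of the same colour and lines of `A`;
  -- quantifying over `r` records this without naming the path.
  rel : ∀ ℓ, ∀ r : Setoid (W ⊕ B), (∀ w, r (Sum.inl w) (Sum.inr (G.color ℓ w))) →
    (∀ e ∈ A, r (Sum.inl (G.whiteEnd e)) (Sum.inr (G.blackEnd e))) →
    ∀ w, r (Sum.inl w) (Sum.inr (c ℓ w))

theorem isContraction_empty (G : TensorGraph W B L) : G.IsContraction G.color ∅ :=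
  ⟨by simp, fun _ _ h _ => h⟩

theorem IsContraction.insert {G : TensorGraph W B L} {c : Fin 4 → W ≃ B} {A : Set L}
    (h : G.IsContraction c A) {e : L} (he : e ∉ A) :
    G.IsContraction (contractLine c (G.whiteEnd e) (G.blackEnd e)) (insert e A) := by
  classical
  constructor
  · intro ℓ e' he'
    rcases Set.mem_insert_iff.1 he' with rfl | he'
    · simp [contractLine]
    · have hne : e' ≠ e := fun h => he (h ▸ he')
      simp only [contractLine, Equiv.trans_apply, h.isolated ℓ e' he']
      refine Equiv.swap_apply_of_ne_of_ne (fun h => hne (G.blackEnd.injective h)) fun h' => ?_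
      rw [← h.isolated ℓ e' he'] at h'
      exact hne (G.whiteEnd.injective ((c ℓ).injective h'))
  · intro ℓ r hc hl w
    have h1 := h.rel ℓ r hc fun e' he' => hl e' (Set.mem_insert_of_mem _ he')
    have h2 := hl e (Set.mem_insert _ _)
    simp only [contractLine, Equiv.trans_apply]
    by_cases hb : c ℓ w = G.blackEnd e
    · rw [hb, Equiv.swap_apply_left]
      have h3 := h1 w
      rw [hb] at h3
      exact r.trans h3 (r.trans (r.symm h2) (h1 _))
    · by_cases hw : w = G.whiteEnd e
      · subst hw
        rw [Equiv.swap_apply_right]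
        exact h2
      · rw [Equiv.swap_apply_of_ne_of_ne hb fun h => hw ((c ℓ).injective h)]
        exact h1 w

theorem exists_isContraction [Finite L] (G : TensorGraph W B L) (A : Set L) :
    ∃ c, G.IsContraction c A := by
  refine Set.Finite.induction_on (motive := fun A _ => ∃ c, G.IsContraction c A) A A.toFinite
    ⟨_, G.isContraction_empty⟩ ?_
  rintro e s he - ⟨c, hc⟩
  exact ⟨_, hc.insert he⟩

/-- A line is joined to itself by the faces that run otherwise through contracted lines. -/
theorem IsContraction.eq_blackEnd {G : TensorGraph W B L} {c : Fin 4 → W ≃ B} {A : Set L}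
    (h : G.IsContraction c A) {e : L} {ℓ : Fin 4} (hcl : G.IsClosedFace (G.faceAt ℓ e))
    (hA : ∀ e', G.OnFace e' (G.faceAt ℓ e) → e' = e ∨ e' ∈ A) :
    c ℓ (G.whiteEnd e) = G.blackEnd e := by
  have hr : Sum.inr (c ℓ (G.whiteEnd e)) ∈ (G.faceAt ℓ e).2.supp := by
    rw [SimpleGraph.ConnectedComponent.mem_supp_iff]
    refine (SimpleGraph.ConnectedComponent.sound ?_).symm
    exact h.rel ℓ (G.coloredPart {none, some ℓ}).reachableSetoid
      (fun w => G.reachable_color (by simp) w) (fun e _ => G.reachable_line (by simp) e)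
      (G.whiteEnd e)
  obtain ⟨e', he', hon⟩ := hcl.exists_black hr
  rcases hA e' hon with rfl | hmem
  · exact he'.symm
  -- A contracted `e'` is already paired with its own white end, so injectivity of `c ℓ` forces `e'
  -- = e`.
  · rw [← h.isolated ℓ e' hmem] at he'
    obtain rfl := G.whiteEnd.injective ((c ℓ).injective he')
    exact h.isolated ℓ e' hmem

/-- The ends of a line on such a face are related by any relation that contains the coloured
lines and the other lines of the face. -/
theorem rel_ends_of_closed [Finite L] (G : TensorGraph W B L) (r : Setoid (W ⊕ B)) {e : L}
    {ℓ : Fin 4} (hc : ∀ w, r (Sum.inl w) (Sum.inr (G.color ℓ w)))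
    (hcl : G.IsClosedFace (G.faceAt ℓ e))
    (hl : ∀ e', G.OnFace e' (G.faceAt ℓ e) → e' ≠ e →
      r (Sum.inl (G.whiteEnd e')) (Sum.inr (G.blackEnd e'))) :
    r (Sum.inl (G.whiteEnd e)) (Sum.inr (G.blackEnd e)) := by
  -- Once all other lines of the face are contracted, the ends of `e` are joined directly.
  obtain ⟨c, hcA⟩ := G.exists_isContraction {e' | G.OnFace e' (G.faceAt ℓ e) ∧ e' ≠ e}
  have h := hcA.rel ℓ r hc (fun e' he' => hl e' he'.1 he'.2) (G.whiteEnd e)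
  rwa [hcA.eq_blackEnd hcl fun e' he' => or_iff_not_imp_left.2 fun hne => ⟨he', hne⟩] at h

/-! ### Lines that close faces -/

/-- The face of colour `ℓ` through `e` is internal to `H`, and `e` is its last line. -/
def Closes (G : TensorGraph W B L) (ρ : L → ℕ) (H : Set L) (e : L) (ℓ : Fin 4) : Prop :=
  G.IsInternalFace H (G.faceAt ℓ e) ∧ ∀ e', G.OnFace e' (G.faceAt ℓ e) → ρ e' ≤ ρ e

/-- The number of internal faces of `H` that are closed by the line `e`. -/
def closingNumber (G : TensorGraph W B L) (ρ : L → ℕ) (H : Set L) (e : L) : ℕ :=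
  {ℓ | G.Closes ρ H e ℓ}.ncard

/-- An order of the lines in which no line closes all its faces. -/
def IsGoodOrder (G : TensorGraph W B L) (ρ : L → ℕ) : Prop :=
  ρ.Injective ∧ ∀ e, ∃ ℓ, ¬ G.IsClosedFace (G.faceAt ℓ e) ∨
    ∃ e', G.OnFace e' (G.faceAt ℓ e) ∧ ρ e < ρ e'

theorem IsGoodOrder.closingNumber_le {G : TensorGraph W B L} {ρ : L → ℕ} (h : G.IsGoodOrder ρ)
    (H : Set L) (e : L) : G.closingNumber ρ H e ≤ 3 := by
  obtain ⟨ℓ, hℓ⟩ := h.2 e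
  have hsub : {ℓ | G.Closes ρ H e ℓ} ⊆ {ℓ}ᶜ := by
    rintro ℓ' ⟨⟨h1, -⟩, h2⟩ rfl
    rcases hℓ with h3 | ⟨e', h3, h4⟩
    · exact h3 h1
    · exact absurd (h2 e' h3) (not_le.2 h4)
  calc _ ≤ ({ℓ}ᶜ : Set (Fin 4)).ncard := Set.ncard_le_ncard hsub
    _ = 3 := by rw [Set.ncard_compl, Set.ncard_singleton, Nat.card_fin]

theorem exists_injective_refine {α : Type*} [Finite α] (k : α → ℕ) :
    ∃ ρ : α → ℕ, ρ.Injective ∧ ∀ a b, k a < k b → ρ a < ρ b := by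
  obtain ⟨n, ⟨φ⟩⟩ := Finite.exists_equiv_fin α
  have lt : ∀ a b, k a < k b → n * k a + φ a < n * k b + φ b := fun a b h => by
    have h1 := (φ a).2
    have h2 : n * (k a + 1) ≤ n * k b := Nat.mul_le_mul_left _ h
    rw [Nat.mul_add] at h2
    omega
  refine ⟨fun a => n * k a + φ a, fun a b h => ?_, lt⟩
  rcases lt_trichotomy (k a) (k b) with h1 | h1 | h1
  · exact absurd h (lt a b h1).ne
  · simp only [h1] at h
    exact φ.injective (Fin.ext (by omega))
  · exact absurd h (lt b a h1).ne'

theorem exists_closer {V : Type*} {Γ : SimpleGraph V} (hΓ : Γ.Connected) {x z : V} (h : x ≠ z) :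
    ∃ y, Γ.Adj x y ∧ Γ.dist y z < Γ.dist x z := by
  obtain ⟨p, hp⟩ := (hΓ x z).exists_walk_length_eq_dist
  cases p with
  | nil => exact absurd rfl h
  | cons hadj q =>
    refine ⟨_, hadj, ?_⟩
    have := SimpleGraph.dist_le q
    rw [SimpleGraph.Walk.length_cons] at hp
    omega

/-- Lines are ordered by decreasing distance to a fixed external node `x₀`. The nearer end of a line
has a neighbour closer still, and the edge to it is coloured because the other end of the line is
not closer. The face of that colour contains this neighbour, which is either an external leg or an
end of a later line. -/
theorem exists_isGoodOrder [Finite L] (G : TensorGraph W B L) (hc : G.IsConnected)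
    (hv : ¬ G.IsVacuum) : ∃ ρ, G.IsGoodOrder ρ := by
  classical
  obtain ⟨x₀, hx₀w, hx₀b⟩ : ∃ x₀ : W ⊕ B, (∀ e, Sum.inl (G.whiteEnd e) ≠ x₀) ∧
      ∀ e, Sum.inr (G.blackEnd e) ≠ x₀ := by
    rw [IsVacuum, not_and_or, not_isEmpty_iff, not_isEmpty_iff] at hv
    rcases hv with ⟨⟨w, hw⟩⟩ | ⟨⟨b, hb⟩⟩
    · exact ⟨Sum.inl w, fun e h => hw ⟨e, Sum.inl_injective h⟩, by simp⟩
    · exact ⟨Sum.inr b, by simp, fun e h => hb ⟨e, Sum.inr_injective h⟩⟩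
  set Γ := G.coloredPart Set.univ
  let δ : L → ℕ := fun e => min (Γ.dist (Sum.inl (G.whiteEnd e)) x₀)
    (Γ.dist (Sum.inr (G.blackEnd e)) x₀)
  obtain ⟨N, hN⟩ : ∃ N, ∀ e, δ e ≤ N := by
    obtain ⟨N, hN⟩ := (Set.finite_range δ).bddAbove
    exact ⟨N, fun e => hN ⟨e, rfl⟩⟩
  obtain ⟨ρ, hρ, hlt⟩ := exists_injective_refine fun e => N - δ e
  have hlt' : ∀ e e', δ e' < δ e → ρ e < ρ e' := fun e e' h => hlt e e' (by
    have := hN e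
    have := hN e'
    omega)
  refine ⟨ρ, hρ, fun e => ?_⟩
  -- the node on the other side of a coloured line closer to the external leg
  have hend : ∀ (ℓ : Fin 4) (y : W ⊕ B), y ∈ (G.faceAt ℓ e).2.supp → Γ.dist y x₀ < δ e →
      ¬ G.IsClosedFace (G.faceAt ℓ e) ∨ ∃ e', G.OnFace e' (G.faceAt ℓ e) ∧ ρ e < ρ e' := by
    intro ℓ y hy hd
    rw [or_iff_not_imp_left, not_not]
    intro hcl
    rcases y with w | b
    · by_cases hr : w ∈ Set.range G.whiteEnd
      · obtain ⟨e', rfl⟩ := hr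
        exact ⟨e', hy, hlt' _ _ ((min_le_left _ _).trans_lt hd)⟩
      · exact absurd hy (hcl.1 ⟨w, hr⟩)
    · obtain ⟨e', rfl, hon⟩ := hcl.exists_black hy
      exact ⟨e', hon, hlt' _ _ ((min_le_right _ _).trans_lt hd)⟩
  have hbmem : ∀ ℓ, Sum.inr (G.blackEnd e) ∈ (G.faceAt ℓ e).2.supp := fun ℓ => by
    rw [SimpleGraph.ConnectedComponent.mem_supp_iff]
    exact (SimpleGraph.ConnectedComponent.sound (G.reachable_line (by simp) e)).symm
  rcases le_total (Γ.dist (Sum.inl (G.whiteEnd e)) x₀) (Γ.dist (Sum.inr (G.blackEnd e)) x₀) with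
    hle | hle
  · have hδ : δ e = Γ.dist (Sum.inl (G.whiteEnd e)) x₀ := min_eq_left hle
    obtain ⟨y, hadj, hd⟩ := exists_closer hc (hx₀w e)
    rw [show G.coloredPart Set.univ = Γ from rfl] at hadj hd
    simp only [Γ, coloredPart, SimpleGraph.fromRel_adj] at hadj
    obtain ⟨-, ⟨k, -, w, b, h1, rfl, h⟩ | ⟨k, -, w, b, -, h1, -⟩⟩ := hadj
    · obtain rfl := Sum.inl_injective h1
      rcases k with - | ℓ
      · obtain ⟨e', h1, rfl⟩ := h
        obtain rfl := G.whiteEnd.injective h1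
        omega
      · refine ⟨ℓ, hend ℓ _ ?_ (hδ ▸ hd)⟩
        rw [SimpleGraph.ConnectedComponent.mem_supp_iff]
        exact (SimpleGraph.ConnectedComponent.sound (G.reachable_of_joined (Or.inr rfl) h)).symm
    · simp at h1
  · have hδ : δ e = Γ.dist (Sum.inr (G.blackEnd e)) x₀ := min_eq_right hle
    obtain ⟨y, hadj, hd⟩ := exists_closer hc (hx₀b e)
    rw [show G.coloredPart Set.univ = Γ from rfl] at hadj hd
    simp only [Γ, coloredPart, SimpleGraph.fromRel_adj] at hadj
    obtain ⟨-, ⟨k, -, w, b, h1, -, -⟩ | ⟨k, -, w, b, rfl, h1, h⟩⟩ := hadj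
    · simp at h1
    · obtain rfl := Sum.inr_injective h1
      rcases k with - | ℓ
      · obtain ⟨e', rfl, h1⟩ := h
        obtain rfl := G.blackEnd.injective h1
        omega
      · refine ⟨ℓ, hend ℓ _ ?_ (hδ ▸ hd)⟩
        have hb := hbmem ℓ
        rw [SimpleGraph.ConnectedComponent.mem_supp_iff] at hb ⊢
        rw [← hb]
        exact SimpleGraph.ConnectedComponent.sound (G.reachable_of_joined (Or.inr rfl) h)

/-! ### Melopoles -/

/-- Contract in the order of `ρ`, `A` being the set already contracted. On a face closed by `e` all
other lines are then contracted, so its colour joins the ends of `e`; three such colours make a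
melonic dipole. -/
theorem isHeppSector_of_closingNumber {G : TensorGraph W B L} {S : Set L} {ρ : L → ℕ}
    (hS : ∀ e ∈ S, 3 ≤ G.closingNumber ρ S e) (l : List L) :
    ∀ (c : Fin 4 → W ≃ B) (A : Set L), G.IsContraction c A → l.Pairwise (fun a b => ρ a < ρ b) →
      (∀ e ∈ A, e ∉ l) → (∀ e ∈ S, e ∈ A ∨ e ∈ l) → (∀ e ∈ l, e ∈ S) → G.IsHeppSector c l := by
  induction l with
  | nil => intro c A _ _ _ _ _; trivial
  | cons e es ih =>
    intro c A hc hl hA hSA hlS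
    rw [List.pairwise_cons] at hl
    have heA : e ∉ A := fun h => hA e h List.mem_cons_self
    have hes : e ∉ es := fun h => lt_irrefl _ (hl.1 e h)
    refine ⟨?_, ih _ _ (hc.insert heA) hl.2 ?_ ?_ fun e' he' => hlS e' (List.mem_cons_of_mem _ he')⟩
    · refine Nat.add_le_add_left ((hS e (hlS e List.mem_cons_self)).trans
        (Set.ncard_le_ncard ?_)) 1
      rintro ℓ ⟨⟨h1, h2⟩, h3⟩
      refine hc.eq_blackEnd h1 fun e' he' => ?_
      rcases hSA e' (h2 e' he') with h | h
      · exact Or.inr h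
      · rcases List.mem_cons.1 h with h | h
        · exact Or.inl h
        · exact absurd (hl.1 e' h) (not_lt.2 (h3 e' he'))
    · rintro e' (rfl | he')
      · exact hes
      · exact fun h => hA e' he' (List.mem_cons_of_mem _ h)
    · intro e' he'
      rcases hSA e' he' with h | h
      · exact Or.inl (Set.mem_insert_of_mem _ h)
      · rcases List.mem_cons.1 h with rfl | h
        · exact Or.inl (Set.mem_insert _ _)
        · exact Or.inr h

theorem exists_sorted_list [Finite L] {ρ : L → ℕ} (hρ : ρ.Injective) (S : Set L) :
    ∃ l : List L, l.Pairwise (fun a b => ρ a < ρ b) ∧ {e | e ∈ l} = S := by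
  classical
  let _ := LinearOrder.lift' ρ hρ
  refine ⟨S.toFinite.toFinset.sort (· ≤ ·), ?_, ?_⟩
  · exact (Finset.sortedLT_sort _).pairwise
  · ext e; simp

/-- A union of blocks in which each line closes three faces contains a melopole. -/
theorem exists_isMelopole [Finite L] {G : TensorGraph W B L} {ρ : L → ℕ} (hρ : ρ.Injective)
    {H T : Set L} (hne : T.Nonempty)
    (hsat : ∀ f, G.IsInternalFace H f → (∀ e, G.OnFace e f → e ∈ T) ∨ ∀ e, G.OnFace e f → e ∉ T)
    (v : G.Bubble) (hv : ∀ e ∈ T, Sum.inl (G.whiteEnd e) ∈ v.supp ∧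
      Sum.inr (G.blackEnd e) ∈ v.supp)
    (hk : ∀ e ∈ T, 3 ≤ G.closingNumber ρ H e) : ∃ S, G.IsMelopole S := by
  -- A minimal nonempty union of blocks is connected. Faces of `H` meeting it are internal to it, so
  -- no closed face is lost in the count.
  let P : Set L → Prop := fun S => S ⊆ T ∧ S.Nonempty ∧
    ∀ f, G.IsInternalFace H f → (∀ e, G.OnFace e f → e ∈ S) ∨ ∀ e, G.OnFace e f → e ∉ S
  obtain ⟨S, hSP, hmin⟩ := (Set.toFinite {S | P S}).exists_minimal ⟨T, subset_rfl, hne, hsat⟩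
  obtain ⟨hST, hSne, hS⟩ : P S := hSP
  have hint : ∀ f, G.IsInternalFace H f → ∀ e ∈ S, G.OnFace e f → G.IsInternalFace S f := by
    intro f hf e he hon
    refine ⟨hf.1, (hS f hf).resolve_right fun h => h e hon he⟩
  refine ⟨S, ⟨hSne, fun S' hS'S hS'ne hS' => ?_⟩, ⟨v, fun e he => hv e (hST he)⟩, ?_⟩
  · refine hS'S.antisymm (hmin ⟨hS'S.trans hST, hS'ne, fun f hf => ?_⟩ hS'S)
    rcases hS f hf with h | h
    · exact hS' f ⟨hf.1, h⟩
    · exact Or.inr fun e he h' => h e he (hS'S h')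
  · obtain ⟨l, hl, hlS⟩ := exists_sorted_list hρ S
    have hmem : ∀ e, e ∈ l ↔ e ∈ S := fun e => by rw [← hlS]; rfl
    refine ⟨l, hl.imp fun h => ?_, hlS, ?_⟩
    · rintro rfl
      exact lt_irrefl _ h
    · refine isHeppSector_of_closingNumber (S := S) (fun e he => ?_) l _ _ G.isContraction_empty
        hl (by simp) (fun e he => Or.inr ((hmem e).2 he)) fun e he => (hmem e).1 he
      refine (hk e (hST he)).trans (Set.ncard_le_ncard ?_)
      rintro ℓ ⟨h1, h2⟩
      exact ⟨hint _ h1 e he (G.onFace_faceAt ℓ e), h2⟩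

/-- Every bubble that is touched by `H` has a line of `H` that closes at most two faces. -/
theorem exists_closingNumber_le_two [Finite L] {G : TensorGraph W B L} (hG : G.FullyConvergent)
    {ρ : L → ℕ} (hρ : ρ.Injective) {H : Set L} (v : G.Bubble) {e₀ : L} (he₀ : e₀ ∈ H)
    (hv : Sum.inl (G.whiteEnd e₀) ∈ v.supp) :
    ∃ e ∈ H, (Sum.inl (G.whiteEnd e) ∈ v.supp ∨ Sum.inr (G.blackEnd e) ∈ v.supp) ∧
      G.closingNumber ρ H e ≤ 2 := by
  -- Two classes: on the bubble `v` or off it. `X` below consists of the lines of `H` with exactly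
  -- one end on `v`.
  let r : Setoid (W ⊕ B) := Setoid.comap (fun x => x ∈ v.supp) (⊥ : Setoid Prop)
  have hr : ∀ x y, r x y ↔ (x ∈ v.supp ↔ y ∈ v.supp) := fun x y => by
    simp [r]
  have hcol : ∀ ℓ w, r (Sum.inl w) (Sum.inr (G.color ℓ w)) := fun ℓ w => by
    rw [hr]
    simp only [SimpleGraph.ConnectedComponent.mem_supp_iff]
    rw [SimpleGraph.ConnectedComponent.sound (G.reachable_color (ℓ := ℓ) (by simp) w)]
  let X : Set L := {e | e ∈ H ∧ ¬ r (Sum.inl (G.whiteEnd e)) (Sum.inr (G.blackEnd e))}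
  rcases X.eq_empty_or_nonempty with hX | hX
  -- If no line of `H` leaves `v`, the lines of `H` at `v` form a union of blocks, and a melopole
  -- would appear if each closed three faces.
  · have hX' : ∀ e ∈ H, r (Sum.inl (G.whiteEnd e)) (Sum.inr (G.blackEnd e)) := fun e he => by
      by_contra h
      exact Set.notMem_empty e (hX ▸ (⟨he, h⟩ : e ∈ X))
    by_contra! hcon
    let T : Set L := {e | e ∈ H ∧ Sum.inl (G.whiteEnd e) ∈ v.supp}
    have hsat : ∀ f, G.IsInternalFace H f →
        (∀ e, G.OnFace e f → e ∈ T) ∨ ∀ e, G.OnFace e f → e ∉ T := fun f hf => by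
      by_cases h : ∃ e, G.OnFace e f ∧ e ∈ T
      · obtain ⟨e, he, heT⟩ := h
        refine Or.inl fun e' he' => ⟨hf.2 e' he', ?_⟩
        exact ((hr _ _).1 (G.rel_of_mem_face r f (hcol f.1) (fun e he => hX' e (hf.2 e he))
          he he')).1 heT.2
      · push Not at h
        exact Or.inr h
    obtain ⟨S, hS⟩ := exists_isMelopole (G := G) hρ (H := H) (T := T) ⟨e₀, he₀, hv⟩ hsat v
      (fun e he => ⟨he.2, ((hr _ _).1 (hX' e he.1)).1 he.2⟩)
      (fun e he => hcon e he.1 (Or.inl he.2))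
    exact hG S hS
  -- A closed face that leaves `v` has to come back through another line of `X`, so the earliest
  -- line of `X` closes no face at all.
  · obtain ⟨e, he, hmin⟩ := Set.exists_min_image X ρ X.toFinite hX
    refine ⟨e, he.1, ?_, ?_⟩
    · have := he.2
      rw [hr] at this
      tauto
    · have hempty : {ℓ | G.Closes ρ H e ℓ} = ∅ := by
        rw [Set.eq_empty_iff_forall_notMem]
        rintro ℓ ⟨h1, h2⟩
        refine he.2 (G.rel_ends_of_closed r (hcol ℓ) h1.1 fun e' he' hne => ?_)
        by_contra h
        exact hne (hρ (le_antisymm (h2 e' he') (hmin e' ⟨h1.2 e' he', h⟩)))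
      simp [closingNumber, hempty]

/-- Each line of `H` has its white end on a bubble that a line of `D` touches. A line of `D` touches
at most two bubbles, each with at most `p` white ends, whence `2 * p`. -/
theorem ncard_le_of_orderLE [Finite W] [Finite B] [Finite L] {G : TensorGraph W B L}
    (hG : G.FullyConvergent) {p : ℕ} (hp : G.OrderLE p) {ρ : L → ℕ} (hρ : ρ.Injective)
    (H : Set L) : H.ncard ≤ 2 * p * {e | e ∈ H ∧ G.closingNumber ρ H e ≤ 2}.ncard := by
  classical
  set D : Set L := {e | e ∈ H ∧ G.closingNumber ρ H e ≤ 2}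
  let bub : W ⊕ B → G.Bubble := fun x => (G.coloredPart {none}ᶜ).connectedComponentMk x
  let N : G.Bubble → Set L := fun v => {e | Sum.inl (G.whiteEnd e) ∈ v.supp}
  have hN : ∀ v, (N v).ncard ≤ p := fun v =>
    (Set.ncard_le_ncard_of_injOn (fun e => Sum.inl (G.whiteEnd e)) (fun e he => he)
      (fun a _ b _ h => G.whiteEnd.injective (Sum.inl_injective h))
      (Set.toFinite _)).trans (hp v)
  have hsub : H ⊆ ⋃ e ∈ D.toFinite.toFinset,
      (N (bub (Sum.inl (G.whiteEnd e))) ∪ N (bub (Sum.inr (G.blackEnd e)))) := by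
    intro e₀ he₀
    obtain ⟨e, he, hve, hk⟩ := exists_closingNumber_le_two hG hρ (bub (Sum.inl (G.whiteEnd e₀)))
      he₀ rfl
    simp only [Set.mem_iUnion, Set.Finite.mem_toFinset]
    refine ⟨e, ⟨he, hk⟩, ?_⟩
    rcases hve with h | h
    · exact Or.inl h.symm
    · exact Or.inr h.symm
  have hfin : ∀ s : Finset L, (⋃ e ∈ s, (N (bub (Sum.inl (G.whiteEnd e))) ∪
      N (bub (Sum.inr (G.blackEnd e))))).ncard ≤ 2 * p * s.card := by
    intro s
    induction s using Finset.induction_on with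
    | empty => simp
    | insert a s ha ih =>
      rw [Finset.set_biUnion_insert, Finset.card_insert_of_notMem ha]
      have h1 := Set.ncard_union_le (N (bub (Sum.inl (G.whiteEnd a))) ∪
        N (bub (Sum.inr (G.blackEnd a)))) (⋃ e ∈ s, (N (bub (Sum.inl (G.whiteEnd e))) ∪
          N (bub (Sum.inr (G.blackEnd e)))))
      have h2 := Set.ncard_union_le (N (bub (Sum.inl (G.whiteEnd a))))
        (N (bub (Sum.inr (G.blackEnd a))))
      have h3 := hN (bub (Sum.inl (G.whiteEnd a)))
      have h4 := hN (bub (Sum.inr (G.blackEnd a)))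
      rw [Nat.mul_add]
      omega
  refine (Set.ncard_le_ncard hsub (Set.toFinite _)).trans ((hfin _).trans_eq ?_)
  rw [Set.ncard_eq_toFinset_card _ D.toFinite]

/-! ### Conserved momenta of the faces -/

theorem sum_faceAt (G : TensorGraph W B L) [Fintype G.Face]
    (n : G.Face → ℝ) (e : L) [DecidablePred fun f => G.OnFace e f] :
    ∑ ℓ, n (G.faceAt ℓ e) = ∑ f with G.OnFace e f, n f := by
  refine Finset.sum_bij (fun ℓ _ => G.faceAt ℓ e) (fun ℓ _ => ?_) (fun a _ b _ h => ?_)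
    (fun f hf => ?_) fun _ _ => rfl
  · simpa using G.onFace_faceAt ℓ e
  · exact congrArg Sigma.fst h
  · exact ⟨f.1, Finset.mem_univ _, (G.onFace_iff e f).1 (by simpa using hf)⟩

/-- Momenta carried by the internal faces of `H` that add up to zero at each line. -/
def momenta (G : TensorGraph W B L) (H : Set L) : Submodule ℝ (G.Face → ℝ) where
  carrier := {n | (∀ f, ¬ G.IsInternalFace H f → n f = 0) ∧ ∀ e, ∑ ℓ, n (G.faceAt ℓ e) = 0}
  add_mem' := by
    rintro a b ⟨h1, h2⟩ ⟨h3, h4⟩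
    exact ⟨fun f hf => by simp [h1 f hf, h3 f hf], fun e => by
      simp [Finset.sum_add_distrib, h2 e, h4 e]⟩
  zero_mem' := ⟨by simp, by simp⟩
  smul_mem' := by
    rintro c a ⟨h1, h2⟩
    exact ⟨fun f hf => by simp [h1 f hf], fun e => by simp [← Finset.mul_sum, h2 e]⟩

theorem IsInternalFace.exists_closes [Finite L] {G : TensorGraph W B L} (ρ : L → ℕ) {H : Set L}
    {f : G.Face} (h : G.IsInternalFace H f) :
    ∃ e ∈ H, G.faceAt f.1 e = f ∧ G.Closes ρ H e f.1 := by
  obtain ⟨e, he, hmax⟩ := Set.exists_max_image {e | G.OnFace e f} ρ (Set.toFinite _)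
    h.1.exists_onFace
  have hf := (G.onFace_iff e f).1 he
  refine ⟨e, h.2 e he, hf, ?_⟩
  rw [Closes, hf]
  exact ⟨h, hmax⟩

/-- Of the momenta of the faces closed by a line, all but one can be free. This leaves at most 2 per
line in a good order, and at most 1 when the line closes at most two faces. -/
theorem finrank_momenta_le [Finite W] [Finite B] [Fintype L] {G : TensorGraph W B L} {ρ : L → ℕ}
    (hρ : G.IsGoodOrder ρ) (H : Set L) :
    Module.finrank ℝ (G.momenta H) +
      {e | e ∈ H ∧ G.closingNumber ρ H e ≤ 2}.ncard ≤ 2 * H.ncard := by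
  classical
  -- at each line, one of the faces it closes is determined by the others
  have hex : ∀ e, ∃ ℓ₀, ∀ ℓ, G.Closes ρ H e ℓ → G.Closes ρ H e ℓ₀ := fun e => by
    by_cases h : ∃ ℓ, G.Closes ρ H e ℓ
    · exact ⟨h.choose, fun _ _ => h.choose_spec⟩
    · exact ⟨0, fun ℓ hℓ => absurd ⟨ℓ, hℓ⟩ h⟩
  choose ℓ₀ hℓ₀ using hex
  let P := Σ e : H, {ℓ // G.Closes ρ H e ℓ ∧ ℓ ≠ ℓ₀ e}
  let φ : G.momenta H →ₗ[ℝ] (P → ℝ) :=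
    { toFun := fun n x => n.1 (G.faceAt x.2.1 x.1)
      map_add' := fun _ _ => rfl
      map_smul' := fun _ _ => rfl }
  have hφ : Function.Injective φ := by
    rw [injective_iff_map_eq_zero]
    rintro ⟨n, hn1, hn2⟩ h0
    have h0' : ∀ e ∈ H, ∀ ℓ, G.Closes ρ H e ℓ → ℓ ≠ ℓ₀ e → n (G.faceAt ℓ e) = 0 :=
      fun e he ℓ h1 h2 => congrFun h0 (⟨⟨e, he⟩, ⟨ℓ, h1, h2⟩⟩ : P)
    obtain ⟨N, hN⟩ : ∃ N, ∀ e, ρ e < N := by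
      obtain ⟨N, hN⟩ := (Set.finite_range ρ).bddAbove
      exact ⟨N + 1, fun e => Nat.lt_succ_of_le (hN ⟨e, rfl⟩)⟩
    -- Induction from the last line down: internal faces through `e` not closed by `e` are closed by
    -- later lines, so conservation at `e` leaves only the term of `ℓ₀ e`.
    have key : ∀ k, ∀ e ∈ H, N - ρ e = k → ∀ ℓ, G.Closes ρ H e ℓ → n (G.faceAt ℓ e) = 0 := by
      intro k
      induction k using Nat.strong_induction_on with
      | _ k ih =>
        intro e he hk ℓ hℓ
        by_cases hne : ℓ = ℓ₀ e
        · have hsum := hn2 e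
          rw [← Finset.sum_erase_add _ _ (Finset.mem_univ ℓ), Finset.sum_eq_zero, zero_add] at hsum
          · exact hsum
          · intro ℓ' hℓ'
            have hne' : ℓ' ≠ ℓ := Finset.ne_of_mem_erase hℓ'
            by_cases hint : G.IsInternalFace H (G.faceAt ℓ' e)
            · by_cases hcl : G.Closes ρ H e ℓ'
              · exact h0' e he ℓ' hcl (hne ▸ hne')
              · obtain ⟨e', he', hf, hcl'⟩ := hint.exists_closes ρ
                have hlt : ρ e < ρ e' := by
                  have h1 := hcl'.2 e (by rw [hf]; exact G.onFace_faceAt _ _)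
                  refine lt_of_le_of_ne h1 fun h => hcl ?_
                  have := hρ.1 h
                  subst this
                  exact hcl'
                have h2 := hN e
                have h3 := hN e'
                rw [← hf]
                exact ih (N - ρ e') (by omega) e' he' rfl _ hcl'
            · exact hn1 _ hint
        · exact h0' e he ℓ hℓ hne
    ext f
    by_cases hf : G.IsInternalFace H f
    · obtain ⟨e, he, hfe, hcl⟩ := hf.exists_closes ρ
      have := key _ e he rfl _ hcl
      rw [hfe] at this
      exact this
    · exact hn1 f hf
  have h1 : Module.finrank ℝ (G.momenta H) ≤ Fintype.card P := by
    have := LinearMap.finrank_le_finrank_of_injective hφ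
    rwa [Module.finrank_fintype_fun_eq_card] at this
  have h2 : Fintype.card P ≤ ∑ e : H, (G.closingNumber ρ H e - 1) := by
    rw [Fintype.card_sigma]
    refine Finset.sum_le_sum fun e _ => ?_
    rw [← Nat.card_eq_fintype_card]
    change ({ℓ | G.Closes ρ H e ℓ ∧ ℓ ≠ ℓ₀ e} : Set (Fin 4)).ncard ≤ _
    by_cases h : ∃ ℓ, G.Closes ρ H e ℓ
    · obtain ⟨ℓ, hℓ⟩ := h
      rw [closingNumber, ← Set.ncard_sdiff_singleton_of_mem (hℓ₀ e ℓ hℓ : ℓ₀ e ∈ _)]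
      rfl
    · have : ({ℓ | G.Closes ρ H e ℓ ∧ ℓ ≠ ℓ₀ e} : Set (Fin 4)) = ∅ := by
        ext ℓ
        simpa using fun hℓ => absurd ⟨ℓ, hℓ⟩ h
      simp [this]
  have h3 : {e | e ∈ H ∧ G.closingNumber ρ H e ≤ 2}.ncard =
      ∑ e : H, if G.closingNumber ρ H e ≤ 2 then 1 else 0 := by
    rw [← Finset.card_filter, ← Set.ncard_coe_finset,
      ← Set.ncard_image_of_injective _ Subtype.val_injective]
    congr 1
    ext e
    simp [and_comm]
  have h4 : 2 * H.ncard = ∑ _e : H, 2 := by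
    rw [Finset.sum_const, Finset.card_univ, ← Nat.card_eq_fintype_card, Nat.card_coe_set_eq,
      smul_eq_mul, mul_comm]
  rw [h3, h4]
  refine (Nat.add_le_add_right (h1.trans h2) _).trans ?_
  rw [← Finset.sum_add_distrib]
  refine Finset.sum_le_sum fun e _ => ?_
  have := hρ.closingNumber_le H e
  split_ifs <;> omega

/-- The number of independent internal momenta is smaller than twice the number of lines. -/
theorem finrank_momenta_bound [Finite W] [Finite B] [Fintype L] {G : TensorGraph W B L}
    (hG : G.FullyConvergent) {p : ℕ} (hp : G.OrderLE p) {ρ : L → ℕ}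
    (hρ : G.IsGoodOrder ρ) (H : Set L) :
    2 * p * Module.finrank ℝ (G.momenta H) + H.ncard ≤ 4 * p * H.ncard := by
  have h1 := Nat.mul_le_mul_left (2 * p) (finrank_momenta_le hρ H)
  have h2 := ncard_le_of_orderLE hG hp hρ.1 H
  linarith

/-! ### Pivots of a space of vectors, and sums by levels -/

/-- The leading coordinates of the elements of a space of vectors. -/
def pivots {ι : Type*} (V : Submodule ℝ (ι → ℝ)) (τ : ι → ℕ) : Set ι :=
  {f | ∃ n ∈ V, n f ≠ 0 ∧ ∀ g, τ g < τ f → n g = 0}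

/-- Vectors with distinct leading coordinates are in echelon form, hence independent. -/
theorem ncard_le_finrank {ι : Type*} [Finite ι] {V : Submodule ℝ (ι → ℝ)} {τ : ι → ℕ}
    (hτ : τ.Injective) {Q : Set ι} (hQ : Q ⊆ pivots V τ) : Q.ncard ≤ Module.finrank ℝ V := by
  classical
  have := Fintype.ofFinite ι
  have hQ' : ∀ f ∈ Q, ∃ n ∈ V, n f ≠ 0 ∧ ∀ g, τ g < τ f → n g = 0 := fun f hf => hQ hf
  choose! n hnV hn0 hn using hQ'
  have hli : LinearIndependent ℝ fun f : Q => (⟨n f, hnV f f.2⟩ : V) := by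
    rw [Fintype.linearIndependent_iff]
    intro c hc
    by_contra! hne
    obtain ⟨f, hf, hmin⟩ := Set.exists_min_image {f : Q | c f ≠ 0} (fun f => τ f) (Set.toFinite _)
      hne
    have h := congrFun (congrArg Subtype.val hc) f
    simp only [AddSubmonoidClass.coe_finsetSum, SetLike.val_smul, Finset.sum_apply,
      Pi.smul_apply, smul_eq_mul, ZeroMemClass.coe_zero, Pi.zero_apply] at h
    rw [Finset.sum_eq_single f] at h
    · rcases mul_eq_zero.1 h with h | h
      · exact hf h
      · exact hn0 f f.2 h
    · intro g _ hg
      by_cases hcg : c g = 0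
      · rw [hcg, zero_mul]
      · rw [hn g g.2 f, mul_zero]
        exact lt_of_le_of_ne (hmin g hcg) fun h => hg (Subtype.ext (hτ h)).symm
    · simp
  have := hli.fintype_card_le_finrank
  rwa [← Nat.card_eq_fintype_card, Nat.card_coe_set_eq] at this

/-- The first nonzero coordinate of a nonzero element of `V` is a pivot. Hence the faces outside the
pivots will have independent holonomies. -/
theorem eq_zero_of_pivots {ι : Type*} [Finite ι] {V : Submodule ℝ (ι → ℝ)} {τ : ι → ℕ}
    {n : ι → ℝ} (hn : n ∈ V) (h : ∀ f ∈ pivots V τ, n f = 0) : n = 0 := by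
  by_contra hne
  obtain ⟨f₀, hf₀⟩ := Function.ne_iff.1 hne
  obtain ⟨f, hf, hmin⟩ := Set.exists_min_image {f | n f ≠ 0} τ (Set.toFinite _) ⟨f₀, hf₀⟩
  refine hf (h f ⟨n, hn, hf, fun g hg => ?_⟩)
  by_contra h'
  exact absurd (hmin g h') (not_le.2 hg)

theorem sum_eq_sum_levels {α : Type*} (s : Finset α) (k : α → ℕ) {N : ℕ} (hN : ∀ a ∈ s, k a ≤ N) :
    ∑ a ∈ s, k a = ∑ i ∈ Finset.range N, {a | a ∈ s ∧ i < k a}.ncard := by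
  classical
  have h : ∀ i, {a | a ∈ s ∧ i < k a}.ncard = ∑ a ∈ s, if i < k a then 1 else 0 := fun i => by
    rw [← Finset.card_filter, ← Set.ncard_coe_finset]
    congr 1
    ext a
    simp
  simp_rw [h]
  rw [Finset.sum_comm]
  refine Finset.sum_congr rfl fun a ha => ?_
  rw [← Finset.card_filter]
  have : (Finset.range N).filter (fun i => i < k a) = Finset.range (k a) := by
    ext i
    have := hN a ha
    simp
    omega
  rw [this, Finset.card_range]

/-! ### Splitting of the closed faces at given scales -/

/-- The lowest scale of the lines of a face. -/
def faceScale (G : TensorGraph W B L) (μ : L → ℕ) (f : G.Face) : ℕ :=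
  sInf (μ '' {e | G.OnFace e f})

theorem IsClosedFace.exists_faceScale {G : TensorGraph W B L} (μ : L → ℕ) {f : G.Face}
    (h : G.IsClosedFace f) : ∃ e, G.OnFace e f ∧ μ e = G.faceScale μ f :=
  Nat.sInf_mem (Set.Nonempty.image μ h.exists_onFace)

theorem faceScale_le (G : TensorGraph W B L) (μ : L → ℕ) {f : G.Face} {e : L}
    (h : G.OnFace e f) : G.faceScale μ f ≤ μ e :=
  Nat.sInf_le ⟨e, h, rfl⟩

/-- At each scale attribution, the closed faces split into a set `P` of small total scale and
a set of faces with independent holonomies. -/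
theorem exists_face_splitting [Fintype W] [Fintype B] [Fintype L] {G : TensorGraph W B L}
    (hc : G.IsConnected) (hv : ¬ G.IsVacuum) (hG : G.FullyConvergent) {p : ℕ} (hp : G.OrderLE p)
    (μ : L → ℕ) : ∃ P : Finset G.Face, (∀ f ∈ P, G.IsClosedFace f) ∧
      2 * p * (∑ f ∈ P, G.faceScale μ f) + ∑ e, μ e ≤ 4 * p * ∑ e, μ e ∧
      ∀ x : G.Face → ℝ, (∀ f, ¬ (G.IsClosedFace f ∧ f ∉ P) → x f = 0) →
        (∀ e, ∑ ℓ, x (G.faceAt ℓ e) = 0) → x = 0 := by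
  classical
  obtain ⟨ρ, hρ⟩ := G.exists_isGoodOrder hc hv
  obtain ⟨τ, hτ, hlt⟩ := exists_injective_refine (G.faceScale μ)
  have hint : ∀ f, G.IsInternalFace Set.univ f ↔ G.IsClosedFace f := fun f => by
    simp [IsInternalFace]
  -- `P` is the set of pivots for an order of increasing face scale. This one choice is good at all
  -- levels `i` at once.
  refine ⟨(Set.toFinite (pivots (G.momenta Set.univ) τ)).toFinset, ?_, ?_, ?_⟩
  · intro f hf
    obtain ⟨n, hn, hnf, -⟩ := (Set.Finite.mem_toFinset _).1 hf
    by_contra h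
    exact hnf (hn.1 f ((hint f).not.2 h))
  · have hle : ∀ e, μ e ≤ ∑ e, μ e := fun e =>
      Finset.single_le_sum (fun _ _ => Nat.zero_le _) (Finset.mem_univ e)
    have hP : ∀ f ∈ (Set.toFinite (pivots (G.momenta Set.univ) τ)).toFinset,
        G.faceScale μ f ≤ ∑ e, μ e := by
      intro f _
      rcases (μ '' {e | G.OnFace e f}).eq_empty_or_nonempty with h | ⟨-, e, he, -⟩
      · simp [faceScale, h]
      · exact (G.faceScale_le μ he).trans (hle e)
    obtain ⟨N, hN⟩ : ∃ N, ∑ e, μ e = N := ⟨_, rfl⟩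
    rw [hN] at hle hP
    rw [sum_eq_sum_levels _ _ hP, sum_eq_sum_levels Finset.univ μ fun e _ => hle e]
    rw [Finset.mul_sum, Finset.mul_sum, ← Finset.sum_add_distrib]
    refine Finset.sum_le_sum fun i _ => ?_
    simp only [Finset.mem_univ, true_and, Set.Finite.mem_toFinset]
    refine le_trans ?_ (finrank_momenta_bound hG hp hρ {e | i < μ e})
    refine Nat.add_le_add_right (Nat.mul_le_mul_left _ (ncard_le_finrank hτ ?_)) _
    -- A vector with leading scale above `i` vanishes on all closed faces of scale at most `i`, so
    -- it lives on internal faces of the lines of scale above `i`.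
    rintro f ⟨⟨n, hn, hnf, hn0⟩, hif⟩
    refine ⟨n, ⟨fun g hg => ?_, hn.2⟩, hnf, hn0⟩
    by_cases hgc : G.IsClosedFace g
    · refine hn0 g (hlt _ _ (lt_of_le_of_lt ?_ hif))
      by_contra! h
      exact hg ⟨hgc, fun e he => h.trans_le (G.faceScale_le μ he)⟩
    · exact hn.1 g ((hint g).not.2 hgc)
  · intro x hx hsum
    refine eq_zero_of_pivots (τ := τ) (V := G.momenta Set.univ) ⟨fun f hf => hx f ?_, hsum⟩ ?_
    · exact fun h => hf ((hint f).2 h.1)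
    · exact fun f hf => hx f fun h => h.2 ((Set.Finite.mem_toFinset _).2 hf)

end TensorGraph

/-! ### The heat kernel -/

theorem heatKernel_nonneg (α θ : ℝ) : 0 ≤ heatKernel α θ :=
  mul_nonneg (Real.sqrt_nonneg _) (tsum_nonneg fun _ => (Real.exp_pos _).le)

/-- The sum over images in the heat kernel, as an extended nonnegative number. -/
def heatImages (α θ : ℝ) : ENNReal :=
  ∑' n : ℤ, ENNReal.ofReal (Real.exp (-(θ - 2 * Real.pi * n) ^ 2 / (4 * α)))

theorem heatKernel_eq_heatImages (α θ : ℝ) :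
    heatKernel α θ = √(Real.pi / α) * (heatImages α θ).toReal := by
  rw [heatImages, ENNReal.tsum_toReal_eq fun _ => ENNReal.ofReal_ne_top, heatKernel]
  congr 1
  exact tsum_congr fun n => (ENNReal.toReal_ofReal (Real.exp_pos _).le).symm

theorem measurable_heatKernel : Measurable fun x : ℝ × ℝ => heatKernel x.1 x.2 := by
  simp_rw [heatKernel_eq_heatImages, heatImages]
  refine Measurable.mul (by fun_prop) (Measurable.ennreal_toReal ?_)
  exact Measurable.tsum fun n => by fun_prop

theorem heatKernel_periodic (α : ℝ) : Function.Periodic (heatKernel α) (2 * Real.pi) := by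
  intro θ
  unfold heatKernel
  rw [← (Equiv.addRight (1 : ℤ)).tsum_eq]
  congr 1
  refine tsum_congr fun n => ?_
  congr 3
  simp only [Equiv.coe_addRight, Int.cast_add, Int.cast_one]
  ring

theorem summable_gaussian {a : ℝ} (ha : 0 < a) :
    Summable fun n : ℤ => Real.exp (-Real.pi * a * (n : ℝ) ^ 2) := by
  have := summable_pow_mul_jacobiTheta₂_term_bound 0 ha 0
  refine this.congr fun n => ?_
  rw [pow_zero, one_mul]
  congr 1
  push_cast
  ring

theorem tsum_gaussian_anti {a b : ℝ} (ha : 0 < a) (hab : a ≤ b) :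
    ∑' n : ℤ, Real.exp (-Real.pi * b * (n : ℝ) ^ 2) ≤
      ∑' n : ℤ, Real.exp (-Real.pi * a * (n : ℝ) ^ 2) := by
  refine (summable_gaussian (ha.trans_le hab)).tsum_le_tsum (fun n => ?_) (summable_gaussian ha)
  refine Real.exp_le_exp.2 ?_
  have := mul_le_mul_of_nonneg_left hab (mul_nonneg Real.pi_pos.le (sq_nonneg (n : ℝ)))
  linarith

/-- After reduction to `|φ| ≤ π` one has `|φ - 2πn| ≥ π|n|`, which makes the bound uniform in the
angle. -/
theorem heatKernel_le_tsum {α : ℝ} (hα : 0 < α) (θ : ℝ) : heatKernel α θ ≤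
    √(Real.pi / α) * ∑' n : ℤ, Real.exp (-Real.pi * (Real.pi / (4 * α)) * (n : ℝ) ^ 2) := by
  have hper : heatKernel α θ = heatKernel α (θ - round (θ / (2 * Real.pi)) * (2 * Real.pi)) :=
    ((heatKernel_periodic α).sub_int_mul_eq _).symm
  rw [hper]
  set φ := θ - round (θ / (2 * Real.pi)) * (2 * Real.pi)
  have hφ : |φ| ≤ Real.pi := by
    have h := abs_sub_round (θ / (2 * Real.pi))
    have h1 : φ = (θ / (2 * Real.pi) - round (θ / (2 * Real.pi))) * (2 * Real.pi) := by
      simp only [φ]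
      field_simp
    rw [h1, abs_mul, abs_of_pos Real.two_pi_pos]
    nlinarith [Real.pi_pos]
  refine mul_le_mul_of_nonneg_left ?_ (Real.sqrt_nonneg _)
  have hs := summable_gaussian (a := Real.pi / (4 * α)) (by have := Real.pi_pos; positivity)
  have hle : ∀ n : ℤ, Real.exp (-(φ - 2 * Real.pi * n) ^ 2 / (4 * α)) ≤
      Real.exp (-Real.pi * (Real.pi / (4 * α)) * (n : ℝ) ^ 2) := by
    intro n
    refine Real.exp_le_exp.2 ?_
    have h1 : (Real.pi * n) ^ 2 ≤ (φ - 2 * Real.pi * n) ^ 2 := by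
      rw [sq_le_sq, abs_mul, abs_of_pos Real.pi_pos]
      rcases eq_or_ne n 0 with rfl | hn
      · simp
      · have hn1 : (1 : ℝ) ≤ |(n : ℝ)| := by exact_mod_cast Int.one_le_abs hn
        have h2 := abs_sub_abs_le_abs_sub (2 * Real.pi * n) φ
        rw [abs_sub_comm (2 * Real.pi * (n : ℝ)) φ, abs_mul, abs_of_pos Real.two_pi_pos] at h2
        nlinarith [Real.pi_pos]
    have h2 : -Real.pi * (Real.pi / (4 * α)) * (n : ℝ) ^ 2 = -(Real.pi * n) ^ 2 / (4 * α) := by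
      ring
    rw [h2]
    gcongr
  exact (Summable.of_nonneg_of_le (fun _ => (Real.exp_pos _).le) hle hs).tsum_le_tsum hle hs

/-- The heat kernel at time at least `R⁻²` is bounded by a multiple of `R`. -/
theorem exists_heatKernel_le : ∃ C : ℝ, 1 ≤ C ∧ ∀ α θ R : ℝ, 0 < α → 1 ≤ R → 1 ≤ α * R ^ 2 →
    heatKernel α θ ≤ C * R := by
  set S : ℝ := ∑' n : ℤ, Real.exp (-Real.pi * 1 * (n : ℝ) ^ 2)
  have hS : 1 ≤ S := by
    have := (summable_gaussian one_pos).le_tsum 0 fun _ _ => (Real.exp_pos _).le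
    simpa [S] using this
  refine ⟨2 * S, by linarith, fun α θ R hα hR hαR => (heatKernel_le_tsum hα θ).trans ?_⟩
  have hpi := Real.pi_pos
  have ha : 0 < Real.pi / (4 * α) := by positivity
  -- For `α ≤ π/4` the sum is at most `S` and the prefactor at most `2 * R`. For larger `α`, Poisson
  -- summation makes the total prefactor exactly 2, with a dual sum at most `S`.
  rcases le_total 1 (Real.pi / (4 * α)) with h | h
  · have h1 := tsum_gaussian_anti one_pos h
    have h2 : √(Real.pi / α) ≤ 2 * R := by
      rw [Real.sqrt_le_left (by positivity), div_le_iff₀ hα]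
      nlinarith [Real.pi_le_four]
    calc _ ≤ 2 * R * S := by gcongr
      _ = _ := by ring
  · have h1 : ∑' n : ℤ, Real.exp (-Real.pi / (Real.pi / (4 * α)) * (n : ℝ) ^ 2) ≤ S := by
      have := tsum_gaussian_anti one_pos ((one_le_inv₀ ha).2 h)
      simpa only [div_eq_mul_inv] using this
    rw [Real.tsum_exp_neg_mul_int_sq ha, ← mul_assoc, ← Real.sqrt_eq_rpow, one_div,
      ← Real.sqrt_inv, ← Real.sqrt_mul (by positivity)]
    have h2 : Real.pi / α * (Real.pi / (4 * α))⁻¹ = 2 ^ 2 := by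
      field_simp
      norm_num
    rw [h2, Real.sqrt_sq (by norm_num)]
    nlinarith

/-! ### The Haar measure of the circle -/

instance fact_two_pi_pos : Fact (0 < 2 * Real.pi) := ⟨Real.two_pi_pos⟩

theorem measurePreserving_haarAngle :
    MeasurePreserving ((↑) : ℝ → AddCircle (2 * Real.pi)) haarAngle AddCircle.haarAddCircle := by
  have h := AddCircle.measurePreserving_mk (2 * Real.pi) 0
  refine ⟨h.measurable, ?_⟩
  have hne : ENNReal.ofReal (2 * Real.pi) ≠ 0 := by simp [Real.pi_pos]
  rw [haarAngle, Measure.map_smul, restrict_Ico_eq_restrict_Ioc,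
    show Set.Ioc 0 (2 * Real.pi) = Set.Ioc 0 (0 + 2 * Real.pi) by rw [zero_add], h.map_eq,
    AddCircle.volume_eq_smul_haarAddCircle, smul_smul,
    ENNReal.inv_mul_cancel hne ENNReal.ofReal_ne_top, one_smul]

instance isProbabilityMeasure_haarAngle : IsProbabilityMeasure haarAngle := by
  refine ⟨?_⟩
  have h := measurePreserving_haarAngle.measure_preimage MeasurableSet.univ.nullMeasurableSet
  simpa using h

/-- The translates of one period tile the line, so the sum over images unfolds to a Gaussian
integral. -/
theorem lintegral_heatImages (α : ℝ) (hα : 0 < α) :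
    ∫⁻ θ in Set.Ico 0 (2 * Real.pi), heatImages α θ = ENNReal.ofReal √(4 * Real.pi * α) := by
  have hT := Real.two_pi_pos
  have hfd := isAddFundamentalDomain_Ioc hT 0 volume
  have h := hfd.lintegral_eq_tsum'' fun x => ENNReal.ofReal (Real.exp (-x ^ 2 / (4 * α)))
  have hb : Function.Bijective fun n : ℤ =>
      (⟨-(n • (2 * Real.pi)), neg_mem (AddSubgroup.zsmul_mem_zmultiples _ n)⟩ :
        AddSubgroup.zmultiples (2 * Real.pi)) := by
    constructor
    · intro a b hab
      simp only [Subtype.mk.injEq, neg_inj] at hab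
      exact (zsmul_left_strictMono hT).injective hab
    · rintro ⟨x, n, rfl⟩
      exact ⟨-n, by simp⟩
  rw [← (Equiv.ofBijective _ hb).tsum_eq] at h
  rw [restrict_Ico_eq_restrict_Ioc]
  unfold heatImages
  rw [lintegral_tsum fun n => by fun_prop]
  calc _ = ∫⁻ x, ENNReal.ofReal (Real.exp (-x ^ 2 / (4 * α))) := by
        rw [h, zero_add]
        refine tsum_congr fun n => lintegral_congr fun x => ?_
        congr 3
        simp only [Equiv.ofBijective_apply, AddSubgroup.vadd_def, vadd_eq_add, zsmul_eq_mul]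
        ring
    _ = ∫⁻ x, ENNReal.ofReal (Real.exp (-(1 / (4 * α)) * x ^ 2)) := by
        refine lintegral_congr fun x => ?_
        congr 2
        ring
    _ = _ := by
        rw [← ofReal_integral_eq_lintegral_ofReal (integrable_exp_neg_mul_sq (by positivity))
          (.of_forall fun _ => (Real.exp_pos _).le), integral_gaussian]
        congr 2
        field_simp

theorem lintegral_heatKernel_le (α : ℝ) :
    ∫⁻ θ, ENNReal.ofReal (heatKernel α θ) ∂haarAngle ≤ 1 := by
  rcases le_or_gt α 0 with hα | hα
  · have h0 : √(Real.pi / α) = 0 :=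
      Real.sqrt_eq_zero_of_nonpos (div_nonpos_of_nonneg_of_nonpos Real.pi_pos.le hα)
    simp [heatKernel, h0]
  · have hpi := Real.pi_pos
    calc _ ≤ ∫⁻ θ, ENNReal.ofReal √(Real.pi / α) * heatImages α θ ∂haarAngle := by
          refine lintegral_mono fun θ => ?_
          rw [heatKernel_eq_heatImages, ENNReal.ofReal_mul (Real.sqrt_nonneg _)]
          gcongr
          exact ENNReal.ofReal_toReal_le
      _ = 1 := by
          rw [lintegral_const_mul' _ _ ENNReal.ofReal_ne_top, haarAngle, lintegral_smul_measure,
            lintegral_heatImages α hα, smul_eq_mul, ← ENNReal.ofReal_inv_of_pos Real.two_pi_pos,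
            ← ENNReal.ofReal_mul (by positivity), ← ENNReal.ofReal_mul (by positivity),
            ENNReal.ofReal_eq_one, mul_comm, mul_assoc, mul_comm (2 * Real.pi)⁻¹,
            ← Real.sqrt_mul (by positivity)]
          have h2 : 4 * Real.pi * α * (Real.pi / α) = (2 * Real.pi) ^ 2 := by
            field_simp
            norm_num
          rw [h2, Real.sqrt_sq Real.two_pi_pos.le, mul_inv_cancel₀ Real.two_pi_pos.ne']

/-- The heat kernel as a function on the circle. -/
def circleKernel (α : ℝ) (x : AddCircle (2 * Real.pi)) : ENNReal :=
  ENNReal.ofReal ((heatKernel_periodic α).lift x)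

theorem circleKernel_coe (α θ : ℝ) : circleKernel α θ = ENNReal.ofReal (heatKernel α θ) := by
  rw [circleKernel, Function.Periodic.lift_coe]

theorem measurable_circleKernel (α : ℝ) : Measurable (circleKernel α) := by
  refine QuotientAddGroup.measurable_from_quotient.2 ?_
  refine ENNReal.measurable_ofReal.comp (?_ : Measurable (heatKernel α))
  exact measurable_heatKernel.comp (measurable_const.prodMk measurable_id)

theorem lintegral_circleKernel_le (α : ℝ) :
    ∫⁻ x, circleKernel α x ∂AddCircle.haarAddCircle ≤ 1 := by
  rw [← measurePreserving_haarAngle.lintegral_comp (measurable_circleKernel α)]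
  simp_rw [circleKernel_coe]
  exact lintegral_heatKernel_le α

theorem lintegral_heatKernel_sub_le (α c : ℝ) :
    ∫⁻ θ, ENNReal.ofReal (heatKernel α (c - θ)) ∂haarAngle ≤ 1 := by
  have h : ∀ θ : ℝ, ENNReal.ofReal (heatKernel α (c - θ)) =
      circleKernel α ((c : AddCircle (2 * Real.pi)) - (θ : AddCircle (2 * Real.pi))) := fun θ => by
    rw [← circleKernel_coe, AddCircle.coe_sub]
  simp_rw [h]
  rw [measurePreserving_haarAngle.lintegral_comp
    (f := fun x => circleKernel α ((c : AddCircle (2 * Real.pi)) - x))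
    ((measurable_circleKernel α).comp (measurable_id.const_sub _)),
    lintegral_sub_left_eq_self (fun x => circleKernel α x) (c : AddCircle (2 * Real.pi))]
  exact lintegral_circleKernel_le α

theorem lintegral_pi_prod {ι : Type*} [Fintype ι] {Ω : Type*} [MeasurableSpace Ω] (ν : Measure Ω)
    [IsProbabilityMeasure ν] (F : ι → Ω → ENNReal) (hF : ∀ i, Measurable (F i)) :
    ∫⁻ x, ∏ i, F i (x i) ∂Measure.pi (fun _ : ι => ν) = ∏ i, ∫⁻ y, F i y ∂ν := by
  rw [ProbabilityTheory.lintegral_prod_eq_prod_lintegral_of_indepFun (μ := Measure.pi fun _ : ι => ν) Finset.univ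
    (fun i x => F i (x i)) (ProbabilityTheory.iIndepFun_pi fun i => (hF i).aemeasurable)
    fun i => (hF i).comp (measurable_pi_apply i)]
  exact Finset.prod_congr rfl fun i _ =>
    (measurePreserving_eval (fun _ : ι => ν) i).lintegral_comp (hF i)

/-- Independent integer combinations of uniform angles are independent uniform angles. -/
theorem lintegral_prod_holonomies {Λ Q : Type*} [Fintype Λ] [DecidableEq Λ] [Fintype Q] (S : Q → Finset Λ)
    (hS : ∀ x : Q → ℝ, (∀ e, ∑ f, (if e ∈ S f then x f else 0) = 0) → x = 0)
    (F : Q → AddCircle (2 * Real.pi) → ENNReal) (hF : ∀ f, Measurable (F f)) :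
    ∫⁻ h, ∏ f, F f ((∑ e ∈ S f, h e : ℝ) : AddCircle (2 * Real.pi))
      ∂Measure.pi (fun _ : Λ => haarAngle) = ∏ f, ∫⁻ y, F f y ∂AddCircle.haarAddCircle := by
  classical
  let T := AddCircle (2 * Real.pi)
  let A : (Λ → ℝ) →ₗ[ℝ] (Q → ℝ) :=
    { toFun := fun h f => ∑ e ∈ S f, h e
      map_add' := fun a b => by ext; simp [Finset.sum_add_distrib]
      map_smul' := fun c a => by ext; simp [Finset.mul_sum] }
  -- A nonzero functional vanishing on the range would be a linear relation between the holonomies,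
  -- which `hS` excludes.
  have hA : Function.Surjective A := by
    rw [← LinearMap.range_eq_top]
    by_contra hne
    obtain ⟨φ, hφ, hle⟩ := Submodule.exists_le_ker_of_lt_top _ (lt_top_iff_ne_top.2 hne)
    have hφx : ∀ y, φ y = ∑ f, φ (Pi.single f 1) * y f := fun y => by
      conv_lhs => rw [pi_eq_sum_univ' y, map_sum]
      refine Finset.sum_congr rfl fun f _ => ?_
      rw [map_smul, smul_eq_mul, mul_comm]
    have hx : (fun f => φ (Pi.single f 1)) = 0 := hS _ fun e => by
      have h1 : φ (A (Pi.single e 1)) = 0 := hle ⟨_, rfl⟩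
      rw [hφx] at h1
      refine Eq.trans ?_ h1
      refine Finset.sum_congr rfl fun f _ => ?_
      simp [A, Pi.single_apply, Finset.sum_ite_eq']
    refine hφ (LinearMap.ext fun y => ?_)
    rw [hφx y]
    simp [fun f => congrFun hx f]
  let Φ : (Λ → T) →+ (Q → T) :=
    { toFun := fun h f => ∑ e ∈ S f, h e
      map_add' := fun a b => by ext; simp [Finset.sum_add_distrib]
      map_zero' := by ext; simp }
  have hcoe : ∀ (s : Finset Λ) (h : Λ → ℝ), ((∑ e ∈ s, h e : ℝ) : T) = ∑ e ∈ s, (h e : T) :=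
    fun s h => map_sum (QuotientAddGroup.mk' (AddSubgroup.zmultiples (2 * Real.pi))) h s
  have hΦ : MeasurePreserving Φ (Measure.pi fun _ => AddCircle.haarAddCircle)
      (Measure.pi fun _ => AddCircle.haarAddCircle) := by
    -- A continuous surjective homomorphism of compact groups carries normalized Haar measure to
    -- normalized Haar measure. Surjectivity on the torus follows by lifting angles to the reals and
    -- using `hA`.
    refine AddMonoidHom.measurePreserving ?_ ?_ (by simp)
    · exact continuous_pi fun f => continuous_finsetSum _ fun e _ => continuous_apply e
    · intro y
      choose t ht using fun f => QuotientAddGroup.mk_surjective (y f)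
      obtain ⟨h, hh⟩ := hA t
      refine ⟨fun e => (h e : T), funext fun f => ?_⟩
      change ∑ e ∈ S f, (h e : T) = y f
      rw [← hcoe, ← ht f, ← hh]
      rfl
  have hcov := measurePreserving_pi (fun _ : Λ => haarAngle)
    (fun _ : Λ => AddCircle.haarAddCircle) fun _ => measurePreserving_haarAngle
  have hG : Measurable fun x : Q → T => ∏ f, F f (x f) :=
    Finset.measurable_prod _ fun f _ => (hF f).comp (measurable_pi_apply f)
  calc _ = ∫⁻ h, ∏ f, F f (Φ (fun e => (h e : T)) f) ∂Measure.pi (fun _ : Λ => haarAngle) := by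
        refine lintegral_congr fun h => Finset.prod_congr rfl fun f _ => ?_
        rw [hcoe]
        rfl
    _ = ∫⁻ h, ∏ f, F f (Φ h f) ∂Measure.pi (fun _ : Λ => AddCircle.haarAddCircle) :=
        hcov.lintegral_comp (hG.comp hΦ.measurable)
    _ = ∫⁻ x, ∏ f, F f (x f) ∂Measure.pi (fun _ : Q => AddCircle.haarAddCircle) :=
        hΦ.lintegral_comp hG
    _ = _ := lintegral_pi_prod _ F hF

namespace TensorGraph

variable {W B L : Type}

/-! ### Open faces -/

/-- An open face has only one black external leg. -/
theorem extBlack_unique (G : TensorGraph W B L) (ℓ : Fin 4) {w : G.ExtWhite} {b b' : G.ExtBlack}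
    (h : (G.coloredPart {none, some ℓ}).Reachable (Sum.inr b.1) (Sum.inl w.1))
    (h' : (G.coloredPart {none, some ℓ}).Reachable (Sum.inr b'.1) (Sum.inl w.1)) : b = b' := by
  -- `R` walks along the face from the white leg and is deterministic. A black leg is where the walk
  -- stops, so there is only one; `w` has no line, so the walk covers the whole component.
  let R : W → W → Prop := fun x y => ∃ e, G.color ℓ x = G.blackEnd e ∧ G.whiteEnd e = y
  have hR : Relator.RightUnique R := by
    rintro x - - ⟨e, h1, rfl⟩ ⟨e', h2, rfl⟩
    rw [G.blackEnd.injective (h1.symm.trans h2)]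
  let S : Set (W ⊕ B) := {x | Sum.elim (Relation.ReflTransGen R w.1)
    (fun b => Relation.ReflTransGen R w.1 ((G.color ℓ).symm b)) x}
  let r : Setoid (W ⊕ B) := Setoid.comap (fun x => x ∈ S) (⊥ : Setoid Prop)
  have hr : ∀ x y, r x y ↔ (x ∈ S ↔ y ∈ S) := fun x y => by simp [r]
  have hS : ∀ k ∈ ({none, some ℓ} : Set (Option (Fin 4))), ∀ x y, G.Joined k x y →
      r (Sum.inl x) (Sum.inr y) := by
    rintro k (rfl | rfl) x y hj
    · obtain ⟨e, rfl, rfl⟩ := hj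
      rw [hr]
      constructor
      · intro hx
        change Relation.ReflTransGen R w.1 (G.whiteEnd e) at hx
        rcases Relation.ReflTransGen.cases_tail hx with heq | ⟨y, hy, e', h1, h2⟩
        · exact absurd ⟨e, heq⟩ w.2
        · obtain rfl := G.whiteEnd.injective h2
          change Relation.ReflTransGen R w.1 ((G.color ℓ).symm (G.blackEnd e'))
          rwa [← h1, Equiv.symm_apply_apply]
      · exact fun hx => Relation.ReflTransGen.tail hx ⟨e, by simp, rfl⟩
    · obtain rfl : G.color ℓ x = y := hj
      rw [hr]
      change Relation.ReflTransGen R w.1 x ↔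
        Relation.ReflTransGen R w.1 ((G.color ℓ).symm (G.color ℓ x))
      rw [Equiv.symm_apply_apply]
  have hmem : ∀ b : G.ExtBlack,
      (G.coloredPart {none, some ℓ}).Reachable (Sum.inr b.1) (Sum.inl w.1) →
      Relation.ReflTransGen R w.1 ((G.color ℓ).symm b.1) := fun b hb =>
    ((hr _ _).1 (G.rel_of_reachable r hS hb)).2 (Relation.ReflTransGen.refl : _)
  have hend : ∀ b : G.ExtBlack, ∀ y, ¬ R ((G.color ℓ).symm b.1) y := by
    rintro b y ⟨e, h1, -⟩
    rw [Equiv.apply_symm_apply] at h1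
    exact b.2 ⟨e, h1.symm⟩
  have heq : (G.color ℓ).symm b.1 = (G.color ℓ).symm b'.1 := by
    rcases Relation.ReflTransGen.total_of_right_unique hR (hmem b h) (hmem b' h') with h1 | h1
    · rcases Relation.ReflTransGen.cases_head h1 with h2 | ⟨y, hy, -⟩
      · exact h2
      · exact absurd hy (hend b y)
    · rcases Relation.ReflTransGen.cases_head h1 with h2 | ⟨y, hy, -⟩
      · exact h2.symm
      · exact absurd hy (hend b' y)
  exact Subtype.ext ((G.color ℓ).symm.injective heq)

/-- By `extBlack_unique` each target angle occurs in at most one kernel, so the integral factorizes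
over the targets. -/
theorem lintegral_openKernel_le [Fintype W] [Fintype B] [Fintype L] (G : TensorGraph W B L)
    (α h : L → ℝ) (g₁ : Fin 4 × G.ExtBlack → ℝ) [Fintype G.ExtWhite] :
    ∫⁻ g₂, ENNReal.ofReal (G.openKernel α h (g₁, g₂)) ∂Measure.pi (fun _ => haarAngle) ≤ 1 := by
  classical
  let F : Fin 4 × G.ExtWhite → ℝ → ENNReal := fun x t => ∏ b : G.ExtBlack,
    if (G.coloredPart {none, some x.1}).Reachable (Sum.inr b.1) (Sum.inl x.2.1) ∧
        G.color x.1 x.2.1 ≠ b.1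
      then ENNReal.ofReal (heatKernel (G.faceSum α (G.openFace x.1 b))
        (g₁ (x.1, b) + G.faceSum h (G.openFace x.1 b) - t))
      else 1
  have hF : ∀ x, Measurable (F x) := fun x => by
    refine Finset.measurable_prod _ fun b _ => ?_
    split_ifs
    · exact ENNReal.measurable_ofReal.comp
        (measurable_heatKernel.comp (measurable_const.prodMk (by fun_prop)))
    · exact measurable_const
  have hF1 : ∀ x, ∫⁻ t, F x t ∂haarAngle ≤ 1 := by
    intro x
    by_cases hb : ∃ b : G.ExtBlack,
        (G.coloredPart {none, some x.1}).Reachable (Sum.inr b.1) (Sum.inl x.2.1)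
    · obtain ⟨b, hb⟩ := hb
      have hFb : ∀ t, F x t = _ := fun t => Finset.prod_eq_single b
        (fun b' _ hne => if_neg fun h' => hne (G.extBlack_unique x.1 h'.1 hb)) (by simp)
      simp_rw [hFb]
      split_ifs
      · exact lintegral_heatKernel_sub_le _ _
      · simp
    · have hFb : ∀ t, F x t = 1 := fun t =>
        Finset.prod_eq_one fun b _ => if_neg fun h' => hb ⟨b, h'.1⟩
      simp [hFb]
  have heq : ∀ g₂, ENNReal.ofReal (G.openKernel α h (g₁, g₂)) = ∏ x, F x (g₂ x) := by
    intro g₂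
    have hnn : ∀ (ℓ : Fin 4) (b : G.ExtBlack) (w : G.ExtWhite), 0 ≤
        if (G.coloredPart {none, some ℓ}).Reachable (Sum.inr b.1) (Sum.inl w.1) ∧
          G.color ℓ w.1 ≠ b.1
        then heatKernel (G.faceSum α (G.openFace ℓ b))
          (g₁ (ℓ, b) + G.faceSum h (G.openFace ℓ b) - g₂ (ℓ, w))
        else 1 := fun ℓ b w => by
      split_ifs
      · exact heatKernel_nonneg _ _
      · exact zero_le_one
    rw [openKernel, ENNReal.ofReal_prod_of_nonneg fun ℓ _ =>
      Finset.prod_nonneg fun b _ => Finset.prod_nonneg fun w _ => by convert! hnn ℓ b w,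
      Fintype.prod_prod_type]
    refine Finset.prod_congr rfl fun ℓ _ => ?_
    rw [Finset.prod_comm, ENNReal.ofReal_prod_of_nonneg fun w _ =>
      Finset.prod_nonneg fun b _ => by convert! hnn ℓ b w]
    refine Finset.prod_congr (by ext; simp) fun w _ => ?_
    rw [ENNReal.ofReal_prod_of_nonneg fun b _ => by convert! hnn ℓ b w]
    refine Finset.prod_congr (by ext; simp) fun b _ => ?_
    dsimp only
    split_ifs <;> simp
  simp_rw [heq]
  rw [lintegral_pi_prod haarAngle F hF]
  exact Finset.prod_le_one' fun x _ => hF1 x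

/-! ### Closed faces -/

-- Kernels of `P` are replaced by their suprema; the remaining holonomies are independent by `hind`
-- and are integrated out.
open Classical in
theorem lintegral_closedKernel_le [Fintype W] [Fintype B] [Fintype L] (G : TensorGraph W B L)
    (α : L → ℝ) (P : Finset G.Face) (hP : ∀ f ∈ P, G.IsClosedFace f)
    (hind : ∀ x : G.Face → ℝ, (∀ f, ¬ (G.IsClosedFace f ∧ f ∉ P) → x f = 0) →
      (∀ e, ∑ ℓ, x (G.faceAt ℓ e) = 0) → x = 0)
    (R : G.Face → ℝ) (hR : ∀ f ∈ P, ∀ θ, heatKernel (G.faceSum α f) θ ≤ R f) :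
    ∫⁻ h, ENNReal.ofReal (G.closedKernel α h) ∂Measure.pi (fun _ => haarAngle) ≤
      ENNReal.ofReal (∏ f ∈ P, R f) := by
  let _ : Fintype G.Face := Fintype.ofFinite G.Face
  let Q := {f : G.Face // G.IsClosedFace f ∧ f ∉ P}
  let S : Q → Finset L := fun f => Finset.univ.filter fun e => G.OnFace e f.1
  have hS : ∀ x : Q → ℝ, (∀ e, ∑ f, (if e ∈ S f then x f else 0) = 0) → x = 0 := by
    intro x hx
    let y : G.Face → ℝ := fun f => if hf : G.IsClosedFace f ∧ f ∉ P then x ⟨f, hf⟩ else 0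
    have hy : y = 0 := by
      refine hind y (fun f hf => dif_neg hf) fun e => ?_
      rw [G.sum_faceAt, ← hx e, Finset.sum_filter]
      have h1 : ∀ f, f ∉ Finset.univ.filter (fun f => G.IsClosedFace f ∧ f ∉ P) →
          (if G.OnFace e f then y f else 0) = 0 := fun f hf => by
        have : y f = 0 := dif_neg (by simpa using hf)
        simp [this]
      rw [← Finset.sum_subset (Finset.subset_univ _) fun f _ hf => h1 f hf,
        Finset.sum_subtype (p := fun f => G.IsClosedFace f ∧ f ∉ P) _ fun f => by simp]
      refine Finset.sum_congr rfl fun f _ => ?_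
      have : y f.1 = x f := dif_pos f.2
      simp [S, this]
    ext f
    have h1 : y f.1 = x f := dif_pos f.2
    rw [← h1, hy]
    rfl
  have hle : ∀ h, ENNReal.ofReal (G.closedKernel α h) ≤ ENNReal.ofReal (∏ f ∈ P, R f) *
      ∏ f : Q, circleKernel (G.faceSum α f.1)
        ((∑ e ∈ S f, h e : ℝ) : AddCircle (2 * Real.pi)) := by
    intro h
    have hsub : P ⊆ Finset.univ.filter fun f => G.IsClosedFace f := fun f hf => by
      simpa using hP f hf
    rw [closedKernel, ← Finset.prod_sdiff hsub, mul_comm,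
      ENNReal.ofReal_mul (Finset.prod_nonneg fun _ _ => heatKernel_nonneg _ _)]
    refine mul_le_mul' ?_ ?_
    · exact ENNReal.ofReal_le_ofReal (Finset.prod_le_prod (fun _ _ => heatKernel_nonneg _ _)
        fun f hf => hR f hf _)
    · rw [ENNReal.ofReal_prod_of_nonneg fun _ _ => heatKernel_nonneg _ _,
        Finset.prod_subtype (p := fun f => G.IsClosedFace f ∧ f ∉ P) _ fun f => by simp]
      refine (Finset.prod_congr rfl fun f _ => ?_).le
      rw [circleKernel_coe]
      rfl
  calc _ ≤ _ := lintegral_mono hle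
    _ = ENNReal.ofReal (∏ f ∈ P, R f) *
        ∏ f : Q, ∫⁻ y, circleKernel (G.faceSum α f.1) y ∂AddCircle.haarAddCircle := by
      rw [lintegral_const_mul' _ _ ENNReal.ofReal_ne_top, lintegral_prod_holonomies S hS
        (fun f => circleKernel (G.faceSum α f.1)) fun f => measurable_circleKernel _]
    _ ≤ _ := mul_le_of_le_one_right' (Finset.prod_le_one' fun f _ => lintegral_circleKernel_le _)

/-! ### Measurability -/

theorem measurable_faceSum [Fintype L] (G : TensorGraph W B L) (f : G.Face) :
    Measurable fun x : L → ℝ => G.faceSum x f :=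
  Finset.measurable_sum _ fun e _ => measurable_pi_apply e

theorem measurable_closedKernel [Fintype W] [Fintype B] [Fintype L] (G : TensorGraph W B L) :
    Measurable fun x : G.Config => G.closedKernel x.1 x.2.1 := by
  unfold closedKernel
  exact Finset.measurable_prod _ fun f _ => measurable_heatKernel.comp
    (((G.measurable_faceSum f).comp measurable_fst).prodMk
      ((G.measurable_faceSum f).comp (measurable_fst.comp measurable_snd)))

theorem measurable_openKernel [Fintype W] [Fintype B] [Fintype L] (G : TensorGraph W B L) :
    Measurable fun x : G.Config => G.openKernel x.1 x.2.1 x.2.2 := by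
  unfold openKernel
  refine Finset.measurable_prod _ fun ℓ _ => Finset.measurable_prod _ fun b _ =>
    Finset.measurable_prod _ fun w _ => ?_
  split_ifs
  · have h1 : Measurable fun x : G.Config => x.1 := measurable_fst
    have h2 : Measurable fun x : G.Config => x.2.1 := measurable_fst.comp measurable_snd
    have h3 : Measurable fun x : G.Config => x.2.2.1 (ℓ, b) :=
      (measurable_pi_apply _).comp (measurable_fst.comp (measurable_snd.comp measurable_snd))
    have h4 : Measurable fun x : G.Config => x.2.2.2 (ℓ, w) :=
      (measurable_pi_apply _).comp (measurable_snd.comp (measurable_snd.comp measurable_snd))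
    have h5 := (G.measurable_faceSum (G.openFace ℓ b)).comp h1
    have h6 := (G.measurable_faceSum (G.openFace ℓ b)).comp h2
    exact measurable_heatKernel.comp (h5.prodMk ((h3.add h6).sub h4))
  · exact measurable_const

theorem measurable_identify (G : TensorGraph W B L) : Measurable G.identify := by
  unfold identify
  refine measurable_fst.prodMk (measurable_pi_iff.2 fun x => ?_)
  split_ifs <;> fun_prop

theorem measurable_integrand [Fintype W] [Fintype B] [Fintype L] (G : TensorGraph W B L) (m : ℝ)
    {u : G.Boundary → ℂ} (hu : Measurable u) : Measurable (G.integrand m u) := by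
  have h1 : Measurable fun x : G.Config => ∏ e, Real.exp (-m ^ 2 * x.1 e) :=
    Finset.measurable_prod _ fun e _ => Real.measurable_exp.comp
      (((measurable_pi_apply e).comp measurable_fst).const_mul _)
  have h2 : Measurable fun x : G.Config => u (G.identify x.2.2) :=
    hu.comp (G.measurable_identify.comp (measurable_snd.comp measurable_snd))
  exact (Complex.measurable_ofReal.comp
    ((h1.mul G.measurable_closedKernel).mul G.measurable_openKernel)).mul h2

end TensorGraph

/-! ### Slices of Schwinger parameters -/

theorem measurableSet_slice (M : ℝ) (i : ℕ) : MeasurableSet (slice M i) := by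
  cases i with
  | zero => exact measurableSet_Ici
  | succ i => exact measurableSet_Icc

theorem slice_lower {M : ℝ} (hM : 1 < M) {i : ℕ} {α : ℝ} (h : α ∈ slice M i) :
    0 < α ∧ 1 ≤ α * (M ^ i) ^ 2 := by
  cases i with
  | zero =>
    have h1 : (1 : ℝ) ≤ α := h
    exact ⟨by linarith, by simpa using h1⟩
  | succ i =>
    have hpos : 0 < M ^ (2 * (i + 1)) := by positivity
    have h1 : (M ^ (2 * (i + 1)))⁻¹ ≤ α := h.1
    refine ⟨(inv_pos.2 hpos).trans_le h1, ?_⟩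
    rw [← pow_mul, mul_comm (i + 1)]
    exact (inv_le_iff_one_le_mul₀ hpos).1 h1

theorem integrableOn_slice {M m : ℝ} (hm : 0 < m) (i : ℕ) :
    IntegrableOn (fun α => Real.exp (-m ^ 2 * α)) (slice M i) := by
  cases i with
  | zero =>
    rw [slice, integrableOn_Ici_iff_integrableOn_Ioi]
    exact integrableOn_exp_mul_Ioi (neg_lt_zero.2 (by positivity)) 1
  | succ i => exact Continuous.integrableOn_Icc (by fun_prop)

/-- The summand `(m ^ 2)⁻¹` serves the unbounded slice `i = 0`, where only the mass gives
convergence. The summand `M ^ 2` compares the upper end of a slice `i ≥ 1` with `M ^ (-2 i)`. -/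
theorem integral_slice_le {M m : ℝ} (hM : 1 < M) (hm : 0 < m) (i : ℕ) :
    ∫ α in slice M i, Real.exp (-m ^ 2 * α) ≤ ((m ^ 2)⁻¹ + M ^ 2) * ((M ^ i) ^ 2)⁻¹ := by
  have hm2 : 0 < m ^ 2 := by positivity
  cases i with
  | zero =>
    rw [slice, integral_Ici_eq_integral_Ioi, integral_exp_mul_Ioi (neg_lt_zero.2 hm2)]
    have h1 : Real.exp (-m ^ 2 * 1) ≤ 1 := Real.exp_le_one_iff.2 (by linarith)
    have h2 : -Real.exp (-m ^ 2 * 1) / -m ^ 2 ≤ (m ^ 2)⁻¹ := by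
      rw [neg_div_neg_eq, div_eq_mul_inv]
      exact mul_le_of_le_one_left (by positivity) h1
    refine h2.trans ?_
    rw [pow_zero, one_pow, inv_one, mul_one]
    exact le_add_of_nonneg_right (sq_nonneg M)
  | succ i =>
    have hle : (M ^ (2 * (i + 1)))⁻¹ ≤ (M ^ (2 * i))⁻¹ := by
      gcongr
      · exact hM.le
      · omega
    have h1 : ∫ α in slice M (i + 1), Real.exp (-m ^ 2 * α) ≤
        ∫ _ in slice M (i + 1), (1 : ℝ) := by
      refine setIntegral_mono_on (integrableOn_slice hm _)
        (integrableOn_const (by simp [slice])) (measurableSet_slice M _) fun α hα => ?_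
      have := (slice_lower hM hα).1
      exact Real.exp_le_one_iff.2 (by nlinarith)
    refine h1.trans ?_
    rw [slice, setIntegral_const, smul_eq_mul, mul_one, Real.volume_real_Icc_of_le hle]
    have h2 : M ^ 2 * ((M ^ (i + 1)) ^ 2)⁻¹ = (M ^ (2 * i))⁻¹ := by
      field_simp
      ring
    have h3 : 0 < (M ^ (2 * (i + 1)))⁻¹ := by positivity
    have h4 : 0 < (m ^ 2)⁻¹ * ((M ^ (i + 1)) ^ 2)⁻¹ := by positivity
    rw [add_mul, h2]
    linarith

/-! ### Sums over scale attributions -/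

theorem sum_prod_geometric_le {Λ : Type*} [Fintype Λ] {D q : ℝ} (hD : 0 ≤ D) (hq0 : 0 ≤ q)
    (hq1 : q < 1) (s : Finset (Λ → ℕ)) :
    ∑ μ ∈ s, ∏ e, D * q ^ μ e ≤ (D * (1 - q)⁻¹) ^ Fintype.card Λ := by
  classical
  obtain ⟨N, hN⟩ : ∃ N, ∀ μ ∈ s, ∀ e, μ e < N := by
    refine ⟨∑ μ ∈ s, ∑ e, μ e + 1, fun μ hμ e => Nat.lt_succ_of_le ?_⟩
    exact (Finset.single_le_sum (fun _ _ => Nat.zero_le _) (Finset.mem_univ e)).trans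
      (Finset.single_le_sum (f := fun μ : Λ → ℕ => ∑ e, μ e) (fun _ _ => Nat.zero_le _) hμ)
  calc _ ≤ ∑ μ ∈ Fintype.piFinset fun _ : Λ => Finset.range N, ∏ e, D * q ^ μ e := by
        refine Finset.sum_le_sum_of_subset_of_nonneg (fun μ hμ => ?_)
          fun _ _ _ => Finset.prod_nonneg fun _ _ => by positivity
        simpa [Fintype.mem_piFinset] using hN μ hμ
    _ = ∏ _e : Λ, ∑ i ∈ Finset.range N, D * q ^ i := by
        rw [Finset.prod_univ_sum]
    _ ≤ ∏ _e : Λ, D * (1 - q)⁻¹ := by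
        refine Finset.prod_le_prod (fun _ _ => Finset.sum_nonneg fun _ _ => by positivity)
          fun _ _ => ?_
        rw [← Finset.mul_sum]
        refine mul_le_mul_of_nonneg_left ?_ hD
        rw [← tsum_geometric_of_lt_one hq0 hq1]
        exact (summable_geometric_of_lt_one hq0 hq1).sum_le_tsum _ fun _ _ => by positivity
    _ = _ := by rw [Finset.prod_const, Finset.card_univ]

/-! ### Power counting -/

namespace TensorGraph

variable {W B L : Type}

theorem openKernel_nonneg [Fintype W] [Fintype B] [Fintype L] (G : TensorGraph W B L)
    (α h : L → ℝ) (g : G.Boundary) : 0 ≤ G.openKernel α h g := by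
  refine Finset.prod_nonneg fun _ _ => Finset.prod_nonneg fun _ _ => Finset.prod_nonneg
    fun _ _ => ?_
  split_ifs
  · exact heatKernel_nonneg _ _
  · exact zero_le_one

theorem closedKernel_nonneg [Fintype W] [Fintype B] [Fintype L] (G : TensorGraph W B L)
    (α h : L → ℝ) : 0 ≤ G.closedKernel α h :=
  Finset.prod_nonneg fun _ _ => heatKernel_nonneg _ _

theorem enorm_integrand_le [Fintype W] [Fintype B] [Fintype L] (G : TensorGraph W B L) (m : ℝ)
    {u : G.Boundary → ℂ} (hu : ∀ g, ‖u g‖ ≤ 1) (x : G.Config) :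
    ‖G.integrand m u x‖ₑ ≤ ENNReal.ofReal (∏ e, Real.exp (-m ^ 2 * x.1 e)) *
      ENNReal.ofReal (G.closedKernel x.1 x.2.1) *
        ENNReal.ofReal (G.openKernel x.1 x.2.1 x.2.2) := by
  have h1 : 0 ≤ ∏ e, Real.exp (-m ^ 2 * x.1 e) := Finset.prod_nonneg fun _ _ => (Real.exp_pos _).le
  have h2 := mul_nonneg h1 (G.closedKernel_nonneg x.1 x.2.1)
  rw [← ENNReal.ofReal_mul h1, ← ENNReal.ofReal_mul h2, ← ofReal_norm]
  refine ENNReal.ofReal_le_ofReal ?_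
  rw [integrand, norm_mul, Complex.norm_real, Real.norm_of_nonneg
    (mul_nonneg h2 (G.openKernel_nonneg _ _ _))]
  exact mul_le_of_le_one_right (mul_nonneg h2 (G.openKernel_nonneg _ _ _)) (hu _)

theorem lintegral_integrand_le [Fintype W] [Fintype B] [Fintype L] (G : TensorGraph W B L)
    {M m : ℝ} (hM : 1 < M) (hm : 0 < m) {C : ℝ}
    (hC : ∀ α θ R : ℝ, 0 < α → 1 ≤ R → 1 ≤ α * R ^ 2 → heatKernel α θ ≤ C * R)
    (μ : L → ℕ) (P : Finset G.Face) (hP : ∀ f ∈ P, G.IsClosedFace f)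
    (hind : ∀ x : G.Face → ℝ, (∀ f, ¬ (G.IsClosedFace f ∧ f ∉ P) → x f = 0) →
      (∀ e, ∑ ℓ, x (G.faceAt ℓ e) = 0) → x = 0)
    {u : G.Boundary → ℂ} (hu : ∀ g, ‖u g‖ ≤ 1) :
    ∫⁻ x, ‖G.integrand m u x‖ₑ ∂(G.scaleMeasure M μ) ≤
      ENNReal.ofReal ((∏ e, ((m ^ 2)⁻¹ + M ^ 2) * ((M ^ μ e) ^ 2)⁻¹) *
        ∏ f ∈ P, C * M ^ G.faceScale μ f) := by
  classical
  set E : (L → ℝ) → ℝ := fun α => ∏ e, Real.exp (-m ^ 2 * α e)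
  set R : ℝ := ∏ f ∈ P, C * M ^ G.faceScale μ f
  set μα : Measure (L → ℝ) := Measure.pi fun e => volume.restrict (slice M (μ e)) with hμα
  have hE0 : ∀ α, 0 ≤ E α := fun α => Finset.prod_nonneg fun _ _ => (Real.exp_pos _).le
  let Ψ : G.Config → ENNReal := fun x => ENNReal.ofReal (E x.1) *
    ENNReal.ofReal (G.closedKernel x.1 x.2.1) * ENNReal.ofReal (G.openKernel x.1 x.2.1 x.2.2)
  have hΨ : Measurable Ψ := by
    have h1 : Measurable fun x : G.Config => E x.1 :=
      Finset.measurable_prod _ fun e _ => Real.measurable_exp.comp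
        (((measurable_pi_apply e).comp measurable_fst).const_mul _)
    exact (h1.ennreal_ofReal.mul G.measurable_closedKernel.ennreal_ofReal).mul
      G.measurable_openKernel.ennreal_ofReal
  have hΨ1 : ∀ α, Measurable fun y => Ψ (α, y) := fun α => hΨ.comp measurable_prodMk_left
  have hΨ2 : ∀ α h, Measurable fun g => Ψ (α, h, g) := fun α h =>
    (hΨ1 α).comp measurable_prodMk_left
  have hmem : ∀ᵐ α ∂μα, ∀ e, α e ∈ slice M (μ e) := by
    rw [hμα, ← Measure.restrict_pi_pi]
    filter_upwards [ae_restrict_mem (MeasurableSet.univ_pi fun e => measurableSet_slice M (μ e))]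
      with α hα e using hα e trivial
  -- The line of lowest scale alone makes `α(f)` at least `M ^ (-2 i_f)`.
  have hclosed : ∀ α : L → ℝ, (∀ e, α e ∈ slice M (μ e)) → ∀ f ∈ P, ∀ θ,
      heatKernel (G.faceSum α f) θ ≤ C * M ^ G.faceScale μ f := by
    intro α hα f hf θ
    obtain ⟨e, he, hμe⟩ := (hP f hf).exists_faceScale μ
    have hle : α e ≤ G.faceSum α f :=
      Finset.single_le_sum (f := α) (fun e _ => (slice_lower hM (hα e)).1.le) (by simpa using he)
    have h1 := slice_lower hM (hα e)
    refine hC _ _ _ (h1.1.trans_le hle) (one_le_pow₀ hM.le) ?_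
    rw [← hμe]
    exact h1.2.trans (mul_le_mul_of_nonneg_right hle (by positivity))
  calc _ ≤ ∫⁻ x, Ψ x ∂(G.scaleMeasure M μ) := lintegral_mono fun x => G.enorm_integrand_le m hu x
    _ = ∫⁻ α, ∫⁻ h, ∫⁻ g₁, ∫⁻ g₂, Ψ (α, h, g₁, g₂) ∂Measure.pi (fun _ => haarAngle)
          ∂Measure.pi (fun _ => haarAngle) ∂Measure.pi (fun _ => haarAngle) ∂μα := by
        rw [scaleMeasure, lintegral_prod _ hΨ.aemeasurable]
        refine lintegral_congr fun α => ?_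
        rw [lintegral_prod _ (hΨ1 α).aemeasurable]
        refine lintegral_congr fun h => ?_
        rw [lintegral_prod _ (hΨ2 α h).aemeasurable]
    _ ≤ ∫⁻ α, ∫⁻ h, ENNReal.ofReal (E α) * ENNReal.ofReal (G.closedKernel α h)
          ∂Measure.pi (fun _ => haarAngle) ∂μα := by
        refine lintegral_mono fun α => lintegral_mono fun h => ?_
        refine (lintegral_mono (g := fun _ => ENNReal.ofReal (E α) *
          ENNReal.ofReal (G.closedKernel α h)) fun g₁ => ?_).trans (by simp)
        dsimp only [Ψ]
        rw [lintegral_const_mul' _ _ (ENNReal.mul_ne_top ENNReal.ofReal_ne_top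
          ENNReal.ofReal_ne_top)]
        exact mul_le_of_le_one_right' (G.lintegral_openKernel_le α h g₁)
    _ ≤ ∫⁻ α, ENNReal.ofReal (E α) * ENNReal.ofReal R ∂μα := by
        refine lintegral_mono_ae ?_
        filter_upwards [hmem] with α hα
        rw [lintegral_const_mul' _ _ ENNReal.ofReal_ne_top]
        exact mul_le_mul_right (G.lintegral_closedKernel_le α P hP hind _ (hclosed α hα)) _
    _ = ENNReal.ofReal (∏ e, ∫ t in slice M (μ e), Real.exp (-m ^ 2 * t)) * ENNReal.ofReal R := by
        rw [lintegral_mul_const' _ _ ENNReal.ofReal_ne_top, ← ofReal_integral_eq_lintegral_ofReal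
          (Integrable.fintype_prod fun e => integrableOn_slice hm (μ e)) (.of_forall hE0)]
        congr 2
        exact integral_fintype_prod_eq_prod fun _ t => Real.exp (-m ^ 2 * t)
    _ ≤ _ := by
        rw [ENNReal.ofReal_mul (Finset.prod_nonneg fun _ _ => by positivity)]
        refine mul_le_mul_left (ENNReal.ofReal_le_ofReal ?_) _
        exact Finset.prod_le_prod (fun e _ => integral_nonneg fun _ => (Real.exp_pos _).le)
          fun e _ => integral_slice_le hM hm (μ e)

theorem card_closedFaces_le [Fintype W] [Fintype B] [Fintype L] (G : TensorGraph W B L)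
    (P : Finset G.Face) (hP : ∀ f ∈ P, G.IsClosedFace f) : P.card ≤ 4 * Fintype.card L := by
  classical
  have hsub : P ⊆ Finset.univ.image fun x : Fin 4 × L => G.faceAt x.1 x.2 := fun f hf => by
    obtain ⟨e, he⟩ := (hP f hf).exists_onFace
    exact Finset.mem_image.2 ⟨(f.1, e), Finset.mem_univ _, (G.onFace_iff e f).1 he⟩
  refine (Finset.card_le_card hsub).trans (Finset.card_image_le.trans_eq ?_)
  simp

/-- Power counting: the amplitudes decay exponentially with the scales of all lines. -/
theorem exists_amplitude_bound {M m : ℝ} (hM : 1 < M) (hm : 0 < m) (p : ℕ) :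
    ∃ D q : ℝ, 0 < D ∧ 0 ≤ q ∧ q < 1 ∧
      ∀ (W B L : Type) [Fintype W] [Fintype B] [Fintype L] (G : TensorGraph W B L),
        G.IsConnected → ¬ G.IsVacuum → G.OrderLE p → G.FullyConvergent →
        ∀ u : G.Boundary → ℂ, (∀ g, ‖u g‖ ≤ 1) → ∀ μ : L → ℕ,
          ∫⁻ x, ‖G.integrand m u x‖ₑ ∂(G.scaleMeasure M μ) ≤
            ENNReal.ofReal (∏ e, D * q ^ μ e) := by
  obtain ⟨C, hC1, hC⟩ := exists_heatKernel_le
  -- Using `p + 1` keeps `n` positive when `p = 0`. The decay per line and unit of scale is `M ^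
  -- (-1/n)`.
  set n : ℕ := 2 * (p + 1) with hn
  set x : ℝ := M ^ ((n : ℝ)⁻¹)
  have hx1 : 1 < x := Real.one_lt_rpow hM (by positivity)
  have hxn : x ^ n = M := Real.rpow_inv_natCast_pow (by linarith) (by omega)
  have hx0 : 0 < x := by linarith
  have hM0 : 0 < M := by linarith
  refine ⟨((m ^ 2)⁻¹ + M ^ 2) * C ^ 4, x⁻¹, by positivity, by positivity, inv_lt_one_of_one_lt₀ hx1,
    ?_⟩
  intro W B L _ _ _ G hc hv hp hG u hu μ
  obtain ⟨P, hP, hscale, hind⟩ := exists_face_splitting hc hv hG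
    (fun v => (hp v).trans (Nat.le_succ p)) μ
  refine (G.lintegral_integrand_le hM hm hC μ P hP hind hu).trans (ENNReal.ofReal_le_ofReal ?_)
  rw [← hn, show 4 * (p + 1) = n * 2 by omega] at hscale
  simp only [Finset.prod_mul_distrib, Finset.prod_const, Finset.prod_inv_distrib,
    Finset.prod_pow, Finset.prod_pow_eq_pow_sum, Finset.card_univ]
  have h1 : C ^ P.card ≤ (C ^ 4) ^ Fintype.card L := by
    rw [← pow_mul]
    exact pow_le_pow_right₀ hC1 (G.card_closedFaces_le P hP)
  -- In powers of `x = M ^ (1/n)` this is exactly the splitting inequality `hscale`.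
  have h2 : ((M ^ ∑ e, μ e) ^ 2)⁻¹ * M ^ (∑ f ∈ P, G.faceScale μ f) ≤ x⁻¹ ^ ∑ e, μ e := by
    rw [inv_pow, inv_mul_le_iff₀ (by positivity), ← div_eq_mul_inv, le_div_iff₀ (by positivity),
      ← pow_mul, ← hxn, ← pow_mul, ← pow_mul, ← pow_add]
    refine pow_le_pow_right₀ hx1.le (hscale.trans_eq ?_)
    ring
  calc _ = ((m ^ 2)⁻¹ + M ^ 2) ^ Fintype.card L * (C ^ P.card *
        (((M ^ ∑ e, μ e) ^ 2)⁻¹ * M ^ (∑ f ∈ P, G.faceScale μ f))) := by ring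
    _ ≤ ((m ^ 2)⁻¹ + M ^ 2) ^ Fintype.card L * ((C ^ 4) ^ Fintype.card L *
        x⁻¹ ^ ∑ e, μ e) := by gcongr
    _ = _ := by ring

end TensorGraph
end

theorem mainTheorem6 (M m : ℝ) (hM : 1 < M) (hm : 0 < m) (p : ℕ) :
    ∃ K : ℝ, 0 < K ∧
      ∀ (W B L : Type) [Fintype W] [Fintype B] [Fintype L] (G : TensorGraph W B L),
        G.IsConnected → ¬ G.IsVacuum → G.OrderLE p → G.FullyConvergent →
        ∀ u : G.Boundary → ℂ, Measurable u → (∀ g, ‖u g‖ ≤ 1) →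
          (∀ μ : L → ℕ, Integrable (G.integrand m u) (G.scaleMeasure M μ)) ∧
          Summable (fun μ : L → ℕ => ‖G.amplitude M m μ u‖) ∧
          ∑' μ : L → ℕ, ‖G.amplitude M m μ u‖ ≤ K ^ Fintype.card L := by
  obtain ⟨D, q, hD, hq0, hq1, hbound⟩ := TensorGraph.exists_amplitude_bound hM hm p
  refine ⟨D * (1 - q)⁻¹, mul_pos hD (inv_pos.2 (sub_pos.2 hq1)), ?_⟩
  intro W B L _ _ _ G hc hv hp hG u hu hu1
  have hle : ∀ μ : L → ℕ, ‖G.amplitude M m μ u‖ ≤ ∏ e, D * q ^ μ e := fun μ => by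
    have hnn : 0 ≤ ∏ e, D * q ^ μ e := Finset.prod_nonneg fun _ _ => by positivity
    rw [← ENNReal.ofReal_le_ofReal_iff hnn, ofReal_norm]
    exact (enorm_integral_le_lintegral_enorm _).trans (hbound W B L G hc hv hp hG u hu1 μ)
  have hsum : ∀ s : Finset (L → ℕ), ∑ μ ∈ s, ‖G.amplitude M m μ u‖ ≤
      (D * (1 - q)⁻¹) ^ Fintype.card L := fun s =>
    (Finset.sum_le_sum fun μ _ => hle μ).trans (sum_prod_geometric_le hD.le hq0 hq1 s)
  exact ⟨fun μ => ⟨(G.measurable_integrand m hu).aestronglyMeasurable,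
      (hbound W B L G hc hv hp hG u hu1 μ).trans_lt ENNReal.ofReal_lt_top⟩,
    summable_of_sum_le (fun _ => norm_nonneg _) hsum,
    Real.tsum_le_of_sum_le (fun _ => norm_nonneg _) hsum⟩
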